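/- Let $N\ge 2$ be an integer, $f:\mathbb R\to\mathbb R$ locally Lipschitz continuous, $I=(0,1)$, $T>0$, $Q_T=[0,1]\times[0,T]$ and $u^0\in C([0,1])$. Consider $$u_t=u_{xx}+\tfrac{N-1}{x}u_x+f(u)\quad (x\in I,\ 0<t\le T),\qquad u_x(0,t)=u(1,t)=0\quad(0<t\le T),\qquad u(x,0)=u^0(x)\quad (x\in I).\tag{1}$$ For a function $u$ on $Q_T$ such that the derivatives below exist and are continuous on $Q_T$ put $$\kappa(u)=\sum_{k=0}^{2}\|\partial_x^k u\|_{L^\infty(Q_T)}+\sum_{l=1}^{2}\|\partial_t^l u\|_{L^\infty(Q_T)}+\sum_{k=1}^{2}\|\partial_t\partial_x^k u\|_{L^\infty(Q_T)} .$$ Write $(w,v)=\int_I x^{N-1}wv\,dx$, $\|v\|=(v,v)^{1/2}$ and $A(w,v)=\int_I x^{N-1}w_xv_x\,dx$. For a partition $0=x_0<x_1<\dots<x_m=1$ let $h_j=x_j-x_{j-1}$ and $h=\max_{1\le j\le m} h_j$; let $S_h$ be the space of continuous functions on $[0,1]$ that are affine on each $(x_{j-1},x_j)$ and vanish at $x=1$;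 let $\phi_i\in S_h$ ($0\le i\le m-1$) be the function with $\phi_i(x_j)=\delta_{ij}$; and let $\langle w,v\rangle=\sum_{i=0}^{m-1}w(x_i)v(x_i)\,(1,\phi_i)$. Let $\tau_j>0$ ($j\ge 0$) be time increments with $\tau=\sup_{j\ge0}\tau_j<\infty$, and let $t_n=\sum_{j=0}^{n-1}\tau_j$. Given $u_h^0\in S_h$, the scheme (ML--1) seeks $u_h^{n+1}\in S_h$, $n=0,1,\dots$, such that $$\Big\langle \frac{u_h^{n+1}-u_h^n}{\tau_n},\chi\Big\rangle+A(u_h^{n+1},\chi)=(f(u_h^n),\chi)\qquad\text{for all }\chi\in S_h .$$ **Theorem (optimal $L^2$ error estimate for (ML--1)).** Let $T,C_0,\beta>0$ and $K\in\mathbb R$. There are positive constants $C$, $h_0$ and $\tau_0$, depending only on $T,f,K,C_0,N,\beta$, with the following property. Let $u$ be a solution of (1) on $[0,T]$ for which all the derivatives occurring in $\kappa(u)$ exist and are continuous on $Q_T$, with $\kappa(u)\le K$. Let the partition satisfy $h\le\beta\min_{1\le j\le m}h_j$, let $h\le h_0$ and $\tau\le\tau_0$, and let $\|u_h^0-u^0\|_{L^\infty(I)}\le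 C_0h^2$. Then the solution $u_h^n$ of (ML--1) satisfies $$\sup_{0\le t_n\le T}\|u_h^n-u(\cdot,t_n)\|\le C(h^2+\tau).$$ -/

import Mathlib

namespace RadialHeat

/-! ### Maximum norms and partial derivatives on the space-time cylinder -/

/-- `max_{p ∈ s} |v p|`; used for functions continuous on a nonempty compact set `s`. -/
noncomputable def maxNorm {α : Type*} (s : Set α) (v : α → ℝ) : ℝ :=
  sSup ((fun p => |v p|) '' s)

/-- The closed cylinder `Q_T = [0,1] × [0,T]`, with points `(x, t)`. -/
def cylinder (T : ℝ) : Set (ℝ × ℝ) := Set.Icc 0 1 ×ˢ Set.Icc 0 T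

/-- `∂v/∂x` on `Q_T` (one-sided at `x = 0` and `x = 1`), for `v = v(x, t)`. -/
noncomputable def dx (v : ℝ × ℝ → ℝ) : ℝ × ℝ → ℝ :=
  fun p => derivWithin (fun y => v (y, p.2)) (Set.Icc 0 1) p.1

/-- `∂v/∂t` on `Q_T` (one-sided at `t = 0` and `t = T`), for `v = v(x, t)`. -/
noncomputable def dt (T : ℝ) (v : ℝ × ℝ → ℝ) : ℝ × ℝ → ℝ :=
  fun p => derivWithin (fun s => v (p.1, s)) (Set.Icc 0 T) p.2

/-- `∂v/∂x` exists at every point of `Q_T` and is continuous on `Q_T`. -/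
def HasContDx (T : ℝ) (v : ℝ × ℝ → ℝ) : Prop :=
  (∀ t ∈ Set.Icc 0 T, DifferentiableOn ℝ (fun y => v (y, t)) (Set.Icc 0 1)) ∧
    ContinuousOn (dx v) (cylinder T)

/-- `∂v/∂t` exists at every point of `Q_T` and is continuous on `Q_T`. -/
def HasContDt (T : ℝ) (v : ℝ × ℝ → ℝ) : Prop :=
  (∀ x ∈ Set.Icc (0 : ℝ) 1, DifferentiableOn ℝ (fun s => v (x, s)) (Set.Icc 0 T)) ∧
    ContinuousOn (dt T v) (cylinder T)

/-- All the derivatives that occur in `κ(u)` exist and are continuous on `Q_T`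
(so that each of the norms in `κ(u)` is a finite maximum). -/
structure IsSmooth (T : ℝ) (u : ℝ × ℝ → ℝ) : Prop where
  cont : ContinuousOn u (cylinder T)
  u_x : HasContDx T u
  u_xx : HasContDx T (dx u)
  u_t : HasContDt T u
  u_tt : HasContDt T (dt T u)
  u_tx : HasContDt T (dx u)
  u_txx : HasContDt T (dx (dx u))

/-- `κ(u)`: the sum of the maximum norms over `Q_T` of
`u, u_x, u_xx, u_t, u_tt, u_tx, u_txx`. -/
noncomputable def kappa (T : ℝ) (u : ℝ × ℝ → ℝ) : ℝ :=
  (maxNorm (cylinder T) u + maxNorm (cylinder T) (dx u) + maxNorm (cylinder T) (dx (dx u)))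
    + (maxNorm (cylinder T) (dt T u) + maxNorm (cylinder T) (dt T (dt T u)))
    + (maxNorm (cylinder T) (dt T (dx u)) + maxNorm (cylinder T) (dt T (dx (dx u))))

/-- `u` is a classical solution on `[0,T]` of
`u_t = u_xx + ((N-1)/x) u_x + f(u)` in `(0,1)`, `u_x(0,t) = u(1,t) = 0`, `u(x,0) = u⁰(x)`. -/
structure IsSolution (N : ℕ) (f : ℝ → ℝ) (u0 : ℝ → ℝ) (T : ℝ) (u : ℝ × ℝ → ℝ) : Prop where
  pde : ∀ x ∈ Set.Ioo (0 : ℝ) 1, ∀ t ∈ Set.Ioc 0 T,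
    dt T u (x, t) = dx (dx u) (x, t) + ((N : ℝ) - 1) / x * dx u (x, t) + f (u (x, t))
  neumann : ∀ t ∈ Set.Ioc 0 T, dx u (0, t) = 0
  dirichlet : ∀ t ∈ Set.Ioc 0 T, u (1, t) = 0
  initial : ∀ x ∈ Set.Ioo (0 : ℝ) 1, u (x, 0) = u0 x

/-! ### Weighted forms -/

/-- `(w, v) = ∫_I x^{N-1} w v dx`, `I = (0,1)`. -/
noncomputable def ip (N : ℕ) (w v : ℝ → ℝ) : ℝ :=
  ∫ x in (0 : ℝ)..1, x ^ (N - 1) * (w x * v x)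

/-- The weighted `L²` norm `‖v‖ = (v, v)^{1/2}`. -/
noncomputable def wnorm (N : ℕ) (v : ℝ → ℝ) : ℝ := Real.sqrt (ip N v v)

/-- `A(w, v) = ∫_I x^{N-1} w_x v_x dx`. It is applied to continuous piecewise affine functions only,
whose weak derivative is the classical one off the finitely many nodes. -/
noncomputable def formA (N : ℕ) (w v : ℝ → ℝ) : ℝ :=
  ∫ x in (0 : ℝ)..1, x ^ (N - 1) * (deriv w x * deriv v x)

/-! ### Meshes and the finite element space -/

/-- A partition `0 = x_0 < x_1 < ⋯ < x_m = 1`. Only `x j` with `j ≤ m` matter. -/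
structure Mesh where
  m : ℕ
  x : ℕ → ℝ
  x_zero : x 0 = 0
  x_last : x m = 1
  x_lt : ∀ j < m, x j < x (j + 1)

namespace Mesh

/-- The length of the element `(x_j, x_{j+1})`, `j = 0, …, m-1`. -/
def step (M : Mesh) (j : ℕ) : ℝ := M.x (j + 1) - M.x j

/-- The granularity `h`, the largest of the `m` element lengths. -/
noncomputable def h (M : Mesh) : ℝ := ⨆ j : Fin M.m, M.step j

/-- Quasi-uniformity with constant `β`: `h ≤ β · min_j h_j`. -/
def QuasiUniform (M : Mesh) (β : ℝ) : Prop := M.h ≤ β * ⨅ j : Fin M.m, M.step j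

/-- Membership in the `P₁` finite element space `S_h`. A function that is affine on every
element belongs to `H¹(I)` iff its representative is continuous on `[0,1]`. Functions are
considered on `[0,1]`; the values elsewhere play no role. -/
structure MemS (M : Mesh) (v : ℝ → ℝ) : Prop where
  cont : ContinuousOn v (Set.Icc 0 1)
  affine : ∀ j < M.m, ∃ a b : ℝ, ∀ y ∈ Set.Ioo (M.x j) (M.x (j + 1)), v y = a * y + b
  right : v 1 = 0

/-- The hat function `φ_i`, `0 ≤ i < m`. For `i = 0` the first case is empty. -/
noncomputable def hat (M : Mesh) (i : ℕ) (y : ℝ) : ℝ :=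
  if M.x (i - 1) ≤ y ∧ y < M.x i then (y - M.x (i - 1)) / (M.x i - M.x (i - 1))
  else if M.x i ≤ y ∧ y ≤ M.x (i + 1) then (M.x (i + 1) - y) / (M.x (i + 1) - M.x i)
  else 0

/-- The mass-lumped product `⟨w, v⟩ = ∑_{i=0}^{m-1} w(x_i) v(x_i) (1, φ_i)`. -/
noncomputable def lump (M : Mesh) (N : ℕ) (w v : ℝ → ℝ) : ℝ :=
  ∑ i ∈ Finset.range M.m, w (M.x i) * v (M.x i) * ip N (fun _ => 1) (M.hat i)

end Mesh

/-- `t_n = τ_0 + ⋯ + τ_{n-1}`. -/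
def time (τ : ℕ → ℝ) (n : ℕ) : ℝ := ∑ j ∈ Finset.range n, τ j

/-- `U n = u_h^n` solves the scheme (ML-1) with time increments `τ n`: all `u_h^n` lie in `S_h` and
`⟨(u_h^{n+1} - u_h^n)/τ_n, χ⟩ + A(u_h^{n+1}, χ) = (f(u_h^n), χ)` for all `χ ∈ S_h`, `n ≥ 0`. -/
structure IsML1 (N : ℕ) (f : ℝ → ℝ) (M : Mesh) (τ : ℕ → ℝ) (U : ℕ → ℝ → ℝ) : Prop where
  mem : ∀ n, M.MemS (U n)
  scheme : ∀ n, ∀ χ, M.MemS χ →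
    M.lump N (fun y => (U (n + 1) y - U n y) / τ n) χ + formA N (U (n + 1)) χ
      = ip N (fun y => f (U n y)) χ

end RadialHeat

open Set MeasureTheory intervalIntegral

namespace RadialHeat

/-! ### Mesh geometry and piecewise affine functions. -/

namespace Mesh

variable (M : Mesh)

/-! Let P be the elliptic projection onto S_h, and split U - u = θ + r with θ = U - Pu and r = Pu -
u. In one dimension P is explicit: on each element the slope of Pu is the x^{N-1}-weighted mean of
u_x (`proj`), so A(Pu, χ) is the exact weak form of the elliptic part. Hence θ solves a lumped
implicit scheme with source (E, χ) - ⟨W, χ⟩, where E = f(U^n) - f(u^{n+1}) + u_t^{n+1} and W is the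
projection of the difference quotient of u in time (`IsML1.err_equation`).

Since f is only locally Lipschitz, U^n must be kept in a fixed interval. Lumping makes the mass
matrix diagonal and the off-diagonal stiffness entries are nonpositive, so a discrete maximum
principle gives stability in the maximum norm (`MemS.abs_step_le`). With the crude bound |r| ≤ K h
(`abs_proj_sub_le`) and a Gronwall induction, |θ| = O(h + τ), which is at most 1 for small h and τ;
then one Lipschitz constant serves for all arguments of f.

The optimal order comes from testing with θ^{n+1} (`MemS.lump_step_le`), where two errors must be of
second order. The lumping error is exactly a sum over elements of products of slopes times a bubble
integral of relative size h² (`MemS.lump_eq`); the slope of the test function is absorbed by A(χ,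
χ). For the projection, the weight is nearly constant on elements away from the origin, so the nodal
error grows by only O(h² h_j / x_j) across an element; summed from x = 1 inwards this is at worst h²
x^{-1/2}, whose square is integrable against x^{N-1} because N ≥ 2 (`weighted_proj_sub_sq_le`). A
second Gronwall induction finishes. -/

lemma m_pos : 0 < M.m := by
  rcases Nat.eq_zero_or_pos M.m with h | h
  · have h1 := M.x_last
    rw [h, M.x_zero] at h1
    norm_num at h1
  · exact h

lemma x_mono {i j : ℕ} (hij : i ≤ j) (hj : j ≤ M.m) : M.x i ≤ M.x j := by
  induction j, hij using Nat.le_induction with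
  | base => exact le_rfl
  | succ k hk ih => exact (ih (by omega)).trans (M.x_lt k (by omega)).le

lemma x_nonneg {j : ℕ} (hj : j ≤ M.m) : 0 ≤ M.x j := by
  simpa [M.x_zero] using M.x_mono (Nat.zero_le j) hj

lemma x_le_one {j : ℕ} (hj : j ≤ M.m) : M.x j ≤ 1 := by
  simpa [M.x_last] using M.x_mono hj le_rfl

lemma x_mem {j : ℕ} (hj : j ≤ M.m) : M.x j ∈ Icc (0 : ℝ) 1 := ⟨M.x_nonneg hj, M.x_le_one hj⟩

lemma elem_subset {j : ℕ} (hj : j < M.m) : Icc (M.x j) (M.x (j + 1)) ⊆ Icc 0 1 :=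
  Icc_subset_Icc (M.x_nonneg hj.le) (M.x_le_one hj)

lemma step_pos {j : ℕ} (hj : j < M.m) : 0 < M.step j := sub_pos.2 (M.x_lt j hj)

lemma step_le_h {j : ℕ} (hj : j < M.m) : M.step j ≤ M.h :=
  le_ciSup (f := fun j : Fin M.m => M.step j) (Set.finite_range _).bddAbove ⟨j, hj⟩

lemma h_pos : 0 < M.h := (M.step_pos M.m_pos).trans_le (M.step_le_h M.m_pos)

lemma QuasiUniform.h_le {M : Mesh} {β : ℝ} (hM : M.QuasiUniform β) (hβ : 0 < β) {j : ℕ}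
    (hj : j < M.m) : M.h ≤ β * M.step j :=
  hM.trans (mul_le_mul_of_nonneg_left
    (ciInf_le (f := fun j : Fin M.m => M.step j) (Set.finite_range _).bddBelow ⟨j, hj⟩) hβ.le)

lemma exists_elem {y : ℝ} (hy : y ∈ Icc (0 : ℝ) 1) :
    ∃ j < M.m, y ∈ Icc (M.x j) (M.x (j + 1)) := by
  have key : ∀ k ≤ M.m, 0 < k → y ≤ M.x k → ∃ j < M.m, y ∈ Icc (M.x j) (M.x (j + 1)) := by
    intro k
    induction k with
    | zero => intro _ h; omega
    | succ k ih =>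
      intro hk _ hyk
      rcases le_total (M.x k) y with h | h
      · exact ⟨k, hk, h, hyk⟩
      · rcases Nat.eq_zero_or_pos k with h0 | h0
        · subst h0
          exact ⟨0, hk, by rw [M.x_zero]; exact hy.1, hyk⟩
        · exact ih (by omega) h0 h
  exact key M.m le_rfl M.m_pos (by rw [M.x_last]; exact hy.2)

/-- The slope of the piecewise affine interpolant of `v` on the element `(x_j, x_{j+1})`. -/
noncomputable def slope (v : ℝ → ℝ) (j : ℕ) : ℝ := (v (M.x (j + 1)) - v (M.x j)) / M.step j

lemma slope_mul_step (v : ℝ → ℝ) {j : ℕ} (hj : j < M.m) :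
    M.slope v j * M.step j = v (M.x (j + 1)) - v (M.x j) :=
  div_mul_cancel₀ _ (M.step_pos hj).ne'

lemma memS_of_affine {v : ℝ → ℝ}
    (h : ∀ j < M.m, ∃ a b : ℝ, ∀ y ∈ Icc (M.x j) (M.x (j + 1)), v y = a * y + b)
    (h1 : v 1 = 0) : M.MemS v := by
  refine ⟨?_, fun j hj => ?_, h1⟩
  · have key : ∀ k ≤ M.m, ContinuousOn v (Icc 0 (M.x k)) := by
      intro k
      induction k with
      | zero => intro _; rw [M.x_zero, Icc_self]; exact continuousOn_singleton _ _
      | succ k ih =>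
        intro hk
        rw [← Icc_union_Icc_eq_Icc (M.x_nonneg (by omega : k ≤ M.m)) (M.x_lt k hk).le]
        refine (ih (by omega)).union_of_isClosed ?_ isClosed_Icc isClosed_Icc
        obtain ⟨a, b, hab⟩ := h k hk
        exact ContinuousOn.congr (by fun_prop) hab
    simpa [M.x_last] using key M.m le_rfl
  · obtain ⟨a, b, hab⟩ := h j hj
    exact ⟨a, b, fun y hy => hab y (Ioo_subset_Icc_self hy)⟩

variable {M}

/-- Continuity carries the affine formula from the open element to its end points. -/
lemma MemS.eq_on_elem {v : ℝ → ℝ} (hv : M.MemS v) {j : ℕ} (hj : j < M.m) {y : ℝ}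
    (hy : y ∈ Icc (M.x j) (M.x (j + 1))) :
    v y = v (M.x j) + M.slope v j * (y - M.x j) := by
  obtain ⟨a, b, hab⟩ := hv.affine j hj
  have hlt := M.x_lt j hj
  have hcl : ∀ y ∈ Icc (M.x j) (M.x (j + 1)), v y = a * y + b := by
    have h1 : closure (Ioo (M.x j) (M.x (j + 1))) = Icc (M.x j) (M.x (j + 1)) :=
      closure_Ioo hlt.ne
    have := Set.EqOn.of_subset_closure (s := Ioo (M.x j) (M.x (j + 1)))
      (t := Icc (M.x j) (M.x (j + 1))) (f := v) (g := fun y => a * y + b) hab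
      (hv.cont.mono (M.elem_subset hj)) (by fun_prop) Ioo_subset_Icc_self h1.ge
    exact this
  have hs : M.slope v j = a := by
    rw [slope, hcl _ (right_mem_Icc.2 hlt.le), hcl _ (left_mem_Icc.2 hlt.le),
      div_eq_iff (M.step_pos hj).ne', step]
    ring
  rw [hs, hcl _ hy, hcl _ (left_mem_Icc.2 hlt.le)]
  ring

lemma MemS.hasDerivAt {v : ℝ → ℝ} (hv : M.MemS v) {j : ℕ} (hj : j < M.m) {y : ℝ}
    (hy : y ∈ Ioo (M.x j) (M.x (j + 1))) : HasDerivAt v (M.slope v j) y := by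
  have he : v =ᶠ[nhds y] fun y => v (M.x j) + M.slope v j * (y - M.x j) := by
    filter_upwards [Ioo_mem_nhds hy.1 hy.2] with z hz
    exact hv.eq_on_elem hj (Ioo_subset_Icc_self hz)
  refine HasDerivAt.congr_of_eventuallyEq ?_ he
  simpa using (((hasDerivAt_id y).sub_const (M.x j)).const_mul (M.slope v j)).const_add (v (M.x j))

lemma MemS.sub {v w : ℝ → ℝ} (hv : M.MemS v) (hw : M.MemS w) : M.MemS (fun y => v y - w y) := by
  refine M.memS_of_affine (fun j hj => ?_) (by simp [hv.right, hw.right])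
  refine ⟨M.slope v j - M.slope w j,
    v (M.x j) - w (M.x j) - (M.slope v j - M.slope w j) * M.x j, fun y hy => ?_⟩
  simp only [hv.eq_on_elem hj hy, hw.eq_on_elem hj hy]
  ring

lemma MemS.abs_le {v : ℝ → ℝ} (hv : M.MemS v) {B : ℝ} (hB : ∀ i ≤ M.m, |v (M.x i)| ≤ B)
    {y : ℝ} (hy : y ∈ Icc (0 : ℝ) 1) : |v y| ≤ B := by
  obtain ⟨j, hj, hyj⟩ := M.exists_elem hy
  have hs := M.step_pos hj
  set s := (y - M.x j) / M.step j with hsdef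
  have hs0 : 0 ≤ s := div_nonneg (sub_nonneg.2 hyj.1) hs.le
  have hs1 : s ≤ 1 := by
    rw [hsdef, div_le_one hs, step]; linarith [hyj.2]
  have e : v y = (1 - s) * v (M.x j) + s * v (M.x (j + 1)) := by
    rw [hv.eq_on_elem hj hyj, slope, hsdef]
    field_simp
    ring
  have h1 := _root_.abs_le.1 (hB j hj.le)
  have h2 := _root_.abs_le.1 (hB (j + 1) hj)
  rw [e, _root_.abs_le]
  constructor <;> nlinarith

variable (M)

/-! ### Hat functions and nodal interpolation. -/

lemma hat_on_elem {i j : ℕ} (hi : i < M.m) (hj : j < M.m) {y : ℝ}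
    (hy : y ∈ Icc (M.x j) (M.x (j + 1))) :
    M.hat i y = (if i = j then (M.x (j + 1) - y) / M.step j else 0)
      + (if i = j + 1 then (y - M.x j) / M.step j else 0) := by
  have hlt := M.x_lt j hj
  rcases lt_trichotomy i j with h | h | h
  · have h1 := M.x_lt i hi
    have h2 := M.x_mono (show i + 1 ≤ j from h) hj.le
    rw [if_neg (by omega), if_neg (by omega), hat, if_neg (by intro h'; linarith [hy.1, h'.2])]
    split_ifs with h3
    · have : y = M.x (i + 1) := by linarith [hy.1, h3.2]
      simp [this]
    · simp
  · subst h
    rw [if_pos rfl, if_neg (by omega), hat, if_neg (by intro h'; linarith [hy.1, h'.2]),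
      if_pos (show M.x i ≤ y ∧ y ≤ M.x (i + 1) from hy), step, add_zero]
  · rcases eq_or_lt_of_le (show j + 1 ≤ i from h) with h' | h'
    · subst h'
      rw [if_neg (by omega), if_pos rfl, hat, step]
      have h2 := M.x_lt (j + 1) hi
      simp only [Nat.add_sub_cancel, zero_add]
      by_cases h3 : y < M.x (j + 1)
      · rw [if_pos ⟨hy.1, h3⟩]
      · have : y = M.x (j + 1) := by linarith [hy.2]
        subst this
        rw [if_neg (by simp), if_pos ⟨le_rfl, h2.le⟩, div_self (by linarith),
          div_self (by linarith)]
    · have h1 : M.x (j + 1) ≤ M.x (i - 1) := M.x_mono (by omega) (by omega)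
      have h2 : M.x (i - 1) < M.x i := by
        have := M.x_lt (i - 1) (by omega)
        rwa [show i - 1 + 1 = i by omega] at this
      rw [if_neg (by omega), if_neg (by omega), hat]
      split_ifs with h3 h4
      · have : y = M.x (i - 1) := by linarith [hy.2, h3.1]
        simp [this]
      · linarith [hy.2, h4.1]
      · simp

lemma hat_memS {i : ℕ} (hi : i < M.m) : M.MemS (M.hat i) := by
  refine M.memS_of_affine (fun j hj => ?_) ?_
  · by_cases h1 : i = j
    · refine ⟨-1 / M.step j, M.x (j + 1) / M.step j, fun y hy => ?_⟩
      rw [M.hat_on_elem hi hj hy, if_pos h1, if_neg (by omega)]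
      ring
    · by_cases h2 : i = j + 1
      · refine ⟨1 / M.step j, -M.x j / M.step j, fun y hy => ?_⟩
        rw [M.hat_on_elem hi hj hy, if_neg h1, if_pos h2]
        ring
      · exact ⟨0, 0, fun y hy => by rw [M.hat_on_elem hi hj hy, if_neg h1, if_neg h2]; ring⟩
  · have hm := M.m_pos
    have e : M.m - 1 + 1 = M.m := by omega
    have hj : M.m - 1 < M.m := by omega
    have hy : (1 : ℝ) ∈ Icc (M.x (M.m - 1)) (M.x (M.m - 1 + 1)) := by
      rw [e, M.x_last]; exact ⟨M.x_le_one hj.le, le_rfl⟩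
    rw [M.hat_on_elem hi hj hy, e, M.x_last, if_neg (by omega : i ≠ M.m)]
    simp

lemma hat_nonneg {i : ℕ} (hi : i < M.m) {y : ℝ} (hy : y ∈ Icc (0 : ℝ) 1) : 0 ≤ M.hat i y := by
  obtain ⟨j, hj, hyj⟩ := M.exists_elem hy
  have hs := M.step_pos hj
  rw [M.hat_on_elem hi hj hyj]
  have h1 : 0 ≤ (M.x (j + 1) - y) / M.step j := div_nonneg (by linarith [hyj.2]) hs.le
  have h2 : 0 ≤ (y - M.x j) / M.step j := div_nonneg (by linarith [hyj.1]) hs.le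
  split_ifs <;> linarith

lemma hat_node {i k : ℕ} (hi : i < M.m) (hk : k ≤ M.m) :
    M.hat i (M.x k) = if i = k then 1 else 0 := by
  rcases Nat.lt_or_ge k M.m with h | h
  · have hs := M.step_pos h
    rw [M.hat_on_elem hi h ⟨le_rfl, (M.x_lt k h).le⟩]
    have : (M.x (k + 1) - M.x k) / M.step k = 1 := div_self hs.ne'
    simp [this]
  · have : k = M.m := le_antisymm hk h
    subst this
    rw [M.x_last, (M.hat_memS hi).right, if_neg (by omega)]

lemma abs_sub_node_le_h {i : ℕ} (hi : i < M.m) {y : ℝ} (hy : y ∈ Icc (0 : ℝ) 1)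
    (hne : M.hat i y ≠ 0) : |y - M.x i| ≤ M.h := by
  obtain ⟨j, hj, hyj⟩ := M.exists_elem hy
  have hs := M.step_le_h hj
  have h1 : i = j ∨ i = j + 1 := by
    by_contra hcon
    push Not at hcon
    exact hne (by rw [M.hat_on_elem hi hj hyj, if_neg hcon.1, if_neg hcon.2, add_zero])
  rw [step] at hs
  rcases h1 with h1 | h1 <;> subst h1 <;> rw [_root_.abs_le] <;>
    constructor <;> linarith [hyj.1, hyj.2]

/-- The piecewise affine function with nodal values `c`. -/
noncomputable def interp (c : ℕ → ℝ) (y : ℝ) : ℝ := ∑ i ∈ Finset.range M.m, c i * M.hat i y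

lemma interp_on_elem {c : ℕ → ℝ} (hc : c M.m = 0) {j : ℕ} (hj : j < M.m) {y : ℝ}
    (hy : y ∈ Icc (M.x j) (M.x (j + 1))) :
    M.interp c y = c j * ((M.x (j + 1) - y) / M.step j)
      + c (j + 1) * ((y - M.x j) / M.step j) := by
  rw [interp, Finset.sum_congr rfl (fun i hi => by
    rw [M.hat_on_elem (Finset.mem_range.1 hi) hj hy])]
  simp only [mul_add, mul_ite, mul_zero, Finset.sum_add_distrib, Finset.sum_ite_eq',
    Finset.mem_range, if_pos hj]
  split_ifs with h
  · rfl
  -- There is no hat at the last node; the term missing from the sum is zero because `c M.m = 0`.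
  · rw [show j + 1 = M.m by omega, hc, zero_mul]

lemma interp_memS {c : ℕ → ℝ} (hc : c M.m = 0) : M.MemS (M.interp c) := by
  refine M.memS_of_affine (fun j hj => ?_) ?_
  · refine ⟨(c (j + 1) - c j) / M.step j,
      (c j * M.x (j + 1) - c (j + 1) * M.x j) / M.step j, fun y hy => ?_⟩
    rw [M.interp_on_elem hc hj hy]
    ring
  · exact Finset.sum_eq_zero fun i hi => by
      rw [(M.hat_memS (Finset.mem_range.1 hi)).right, mul_zero]

lemma interp_node {c : ℕ → ℝ} (hc : c M.m = 0) {k : ℕ} (hk : k ≤ M.m) :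
    M.interp c (M.x k) = c k := by
  rw [interp, Finset.sum_congr rfl (fun i hi => by
    rw [M.hat_node (Finset.mem_range.1 hi) hk])]
  simp only [mul_ite, mul_one, mul_zero, Finset.sum_ite_eq', Finset.mem_range]
  split_ifs with h
  · rfl
  · rw [show k = M.m by omega, hc]

/-! ### Elementwise integration and the Dirichlet form. -/

lemma integral_eq_sum {F : ℝ → ℝ}
    (hF : ∀ j < M.m, IntervalIntegrable F volume (M.x j) (M.x (j + 1))) :
    ∫ y in (0 : ℝ)..1, F y = ∑ j ∈ Finset.range M.m, ∫ y in (M.x j)..(M.x (j + 1)), F y := by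
  rw [sum_integral_adjacent_intervals (fun k hk => hF k hk), M.x_zero, M.x_last]

lemma intervalIntegrable_elem {F : ℝ → ℝ} (hF : ContinuousOn F (Icc 0 1)) {j : ℕ} (hj : j < M.m) :
    IntervalIntegrable F volume (M.x j) (M.x (j + 1)) := by
  refine ContinuousOn.intervalIntegrable ?_
  rw [uIcc_of_le (M.x_lt j hj).le]
  exact hF.mono (M.elem_subset hj)

/-- The weight of the element `(x_j, x_{j+1})`. -/
noncomputable def weight (N : ℕ) (j : ℕ) : ℝ := ∫ y in (M.x j)..(M.x (j + 1)), y ^ (N - 1)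

lemma weight_pos (N : ℕ) {j : ℕ} (hj : j < M.m) : 0 < M.weight N j := by
  refine intervalIntegral_pos_of_pos_on ((continuous_pow _).intervalIntegrable _ _) ?_ (M.x_lt j hj)
  intro y hy
  exact pow_pos ((M.x_nonneg hj.le).trans_lt hy.1) _

lemma sum_weight_le (N : ℕ) : ∑ j ∈ Finset.range M.m, M.weight N j ≤ 1 := by
  simp only [weight]
  rw [← M.integral_eq_sum (fun j _ => (continuous_pow _).intervalIntegrable _ _)]
  have := integral_mono_on (μ := volume) (f := fun y : ℝ => y ^ (N - 1)) (g := fun _ => (1 : ℝ))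
    zero_le_one ((continuous_pow _).intervalIntegrable _ _) (by simp)
    (fun y hy => pow_le_one₀ hy.1 hy.2)
  simpa using this

variable {M}

lemma MemS.formA_eq (N : ℕ) {v χ : ℝ → ℝ} (hv : M.MemS v) (hχ : M.MemS χ) :
    formA N v χ = ∑ j ∈ Finset.range M.m, M.slope v j * M.slope χ j * M.weight N j := by
  have hE : ∀ j < M.m, EqOn (fun y : ℝ => y ^ (N - 1) * (M.slope v j * M.slope χ j))
      (fun y => y ^ (N - 1) * (deriv v y * deriv χ y)) (Ioo (M.x j) (M.x (j + 1))) := by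
    intro j hj y hy
    simp only [(hv.hasDerivAt hj hy).deriv, (hχ.hasDerivAt hj hy).deriv]
  rw [formA, M.integral_eq_sum]
  · refine Finset.sum_congr rfl fun j hj => ?_
    rw [Finset.mem_range] at hj
    rw [← integral_congr_Ioo_of_le (M.x_lt j hj).le (hE j hj),
      intervalIntegral.integral_mul_const, weight, mul_comm]
  · intro j hj
    have h0 : IntervalIntegrable (fun y : ℝ => y ^ (N - 1) * (M.slope v j * M.slope χ j)) volume
      (M.x j) (M.x (j + 1)) := by
      apply Continuous.intervalIntegrable; fun_prop
    refine h0.congr_uIoo ?_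
    rw [uIoo_of_le (M.x_lt j hj).le]
    exact hE j hj

end Mesh

/-! ### The weighted inner product. -/

section ip

variable {N : ℕ}

lemma ip_integrable {v w : ℝ → ℝ} (hv : ContinuousOn v (Icc 0 1)) (hw : ContinuousOn w (Icc 0 1)) :
    IntervalIntegrable (fun x : ℝ => x ^ (N - 1) * (v x * w x)) volume 0 1 := by
  refine ContinuousOn.intervalIntegrable ?_
  rw [uIcc_of_le zero_le_one]
  fun_prop

lemma ip_mono {v w v' w' : ℝ → ℝ} (hv : ContinuousOn v (Icc 0 1)) (hw : ContinuousOn w (Icc 0 1))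
    (hv' : ContinuousOn v' (Icc 0 1)) (hw' : ContinuousOn w' (Icc 0 1))
    (h : ∀ y ∈ Icc (0 : ℝ) 1, v y * w y ≤ v' y * w' y) : ip N v w ≤ ip N v' w' :=
  integral_mono_on zero_le_one (ip_integrable hv hw) (ip_integrable hv' hw') fun y hy =>
    mul_le_mul_of_nonneg_left (h y hy) (pow_nonneg hy.1 _)

lemma ip_nonneg {v w : ℝ → ℝ} (h : ∀ y ∈ Icc (0 : ℝ) 1, 0 ≤ v y * w y) : 0 ≤ ip N v w :=
  integral_nonneg zero_le_one fun y hy => mul_nonneg (pow_nonneg hy.1 _) (h y hy)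

lemma ip_const_mul (c : ℝ) (v w : ℝ → ℝ) : ip N (fun y => c * v y) w = c * ip N v w := by
  simp only [ip]
  rw [← intervalIntegral.integral_const_mul]
  congr 1; ext y; ring

lemma ip_add {v w χ : ℝ → ℝ} (hv : ContinuousOn v (Icc 0 1)) (hw : ContinuousOn w (Icc 0 1))
    (hχ : ContinuousOn χ (Icc 0 1)) :
    ip N (fun y => v y + w y) χ = ip N v χ + ip N w χ := by
  simp only [ip]
  rw [← integral_add (ip_integrable hv hχ) (ip_integrable hw hχ)]
  congr 1; ext y; ring

lemma ip_sub {v w χ : ℝ → ℝ} (hv : ContinuousOn v (Icc 0 1)) (hw : ContinuousOn w (Icc 0 1))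
    (hχ : ContinuousOn χ (Icc 0 1)) :
    ip N (fun y => v y - w y) χ = ip N v χ - ip N w χ := by
  simp only [ip]
  rw [← integral_sub (ip_integrable hv hχ) (ip_integrable hw hχ)]
  congr 1; ext y; ring

lemma ip_congr {v w v' w' : ℝ → ℝ} (h : ∀ y ∈ Icc (0 : ℝ) 1, v y * w y = v' y * w' y) :
    ip N v w = ip N v' w' := by
  refine integral_congr fun y hy => ?_
  rw [uIcc_of_le zero_le_one] at hy
  simp only [h y hy]

/-- On [0,1] the weight x^{N-1} is at most x when N ≥ 2. This converts the pointwise bounds on y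
r(y)², which allow r to grow like y^{-1/2} at the origin, into L² bounds. -/
lemma ip_le_of_weighted_le {v w : ℝ → ℝ} (hN : 2 ≤ N) (hv : ContinuousOn v (Icc 0 1))
    (hw : ContinuousOn w (Icc 0 1)) (hnn : ∀ y ∈ Icc (0 : ℝ) 1, 0 ≤ v y * w y) {B : ℝ}
    (h : ∀ y ∈ Icc (0 : ℝ) 1, y * (v y * w y) ≤ B) : ip N v w ≤ B := by
  have := integral_mono_on (μ := volume) (f := fun x : ℝ => x ^ (N - 1) * (v x * w x))
    (g := fun _ => B) zero_le_one (ip_integrable hv hw) (by simp) (fun y hy => by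
      refine le_trans (mul_le_mul_of_nonneg_right ?_ (hnn y hy)) (h y hy)
      exact pow_le_of_le_one hy.1 hy.2 (by omega))
  rw [ip]
  simpa using this

end ip

/-! ### Mass lumping. -/

namespace Mesh

variable (M : Mesh)

/-- The nodal weight `(1, φ_i)`. -/
noncomputable def mass (N : ℕ) (i : ℕ) : ℝ := ip N (fun _ => 1) (M.hat i)

lemma mass_nonneg (N : ℕ) {i : ℕ} (hi : i < M.m) : 0 ≤ M.mass N i :=
  ip_nonneg fun _ hy => by simpa using M.hat_nonneg hi hy

lemma mass_pos (N : ℕ) {i : ℕ} (hi : i < M.m) : 0 < M.mass N i := by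
  have hc := (M.hat_memS hi).cont
  have h1 := M.x_lt i hi
  have hint := ip_integrable (N := N) (v := fun _ => (1 : ℝ)) continuousOn_const hc
  rw [mass, ip]
  have hsplit : ∫ y in (M.x i)..(M.x (i + 1)), y ^ (N - 1) * (1 * M.hat i y)
      ≤ ∫ y in (0 : ℝ)..1, y ^ (N - 1) * (1 * M.hat i y) := by
    refine integral_mono_interval (M.x_nonneg hi.le) h1.le (M.x_le_one hi) ?_ hint
    refine (ae_restrict_iff' measurableSet_Ioc).2 (Filter.Eventually.of_forall fun _ hy => ?_)
    simpa using mul_nonneg (pow_nonneg hy.1.le _) (M.hat_nonneg hi (Ioc_subset_Icc_self hy))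
  refine lt_of_lt_of_le ?_ hsplit
  refine intervalIntegral_pos_of_pos_on ?_ ?_ h1
  · refine M.intervalIntegrable_elem ?_ hi
    fun_prop
  · intro y hy
    rw [M.hat_on_elem hi hi (Ioo_subset_Icc_self hy), if_pos rfl, if_neg (by omega)]
    have h2 : 0 < y := (M.x_nonneg hi.le).trans_lt hy.1
    have h3 : 0 < (M.x (i + 1) - y) / M.step i := div_pos (by linarith [hy.2]) (M.step_pos hi)
    positivity

/-- `∫ x^{N-1} (x - x_j) (x_{j+1} - x) dx` over the element `(x_j, x_{j+1})`. -/
noncomputable def bubble (N : ℕ) (j : ℕ) : ℝ :=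
  ∫ y in (M.x j)..(M.x (j + 1)), y ^ (N - 1) * ((y - M.x j) * (M.x (j + 1) - y))

lemma bubble_nonneg (N : ℕ) {j : ℕ} (hj : j < M.m) : 0 ≤ M.bubble N j :=
  integral_nonneg (M.x_lt j hj).le fun _ hy =>
    mul_nonneg (pow_nonneg ((M.x_nonneg hj.le).trans hy.1) _)
      (mul_nonneg (sub_nonneg.2 hy.1) (sub_nonneg.2 hy.2))

lemma bubble_le (N : ℕ) {j : ℕ} (hj : j < M.m) : M.bubble N j ≤ M.h ^ 2 * M.weight N j := by
  rw [weight, bubble, ← intervalIntegral.integral_const_mul]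
  refine integral_mono_on (M.x_lt j hj).le (by apply Continuous.intervalIntegrable; fun_prop)
    (by apply Continuous.intervalIntegrable; fun_prop) fun y hy => ?_
  have h0 := M.step_le_h hj
  rw [step] at h0
  have h1 : (y - M.x j) * (M.x (j + 1) - y) ≤ M.h ^ 2 := by
    rw [sq]
    exact mul_le_mul (by linarith [hy.2]) (by linarith [hy.1]) (by linarith [hy.2]) M.h_pos.le
  rw [mul_comm (M.h ^ 2)]
  exact mul_le_mul_of_nonneg_left h1 (pow_nonneg ((M.x_nonneg hj.le).trans hy.1) _)

variable {M}

/-- Lumping integrates the nodal interpolant of vχ. On an element vχ is quadratic with leading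
coefficient the product of the slopes, so the interpolant exceeds it by that product times (y -
x_j)(x_{j+1} - y). -/
lemma MemS.lump_eq (N : ℕ) {v χ : ℝ → ℝ} (hv : M.MemS v) (hχ : M.MemS χ) :
    M.lump N v χ = ip N v χ
      + ∑ j ∈ Finset.range M.m, M.slope v j * M.slope χ j * M.bubble N j := by
  set c : ℕ → ℝ := fun i => v (M.x i) * χ (M.x i) with hc
  have hc0 : c M.m = 0 := by simp only [hc, M.x_last, hχ.right, mul_zero]
  have hI := (M.interp_memS hc0).cont
  have h1 : M.lump N v χ = ∫ y in (0 : ℝ)..1, y ^ (N - 1) * M.interp c y := by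
    simp only [interp, Finset.mul_sum, lump]
    rw [intervalIntegral.integral_finsetSum]
    · refine Finset.sum_congr rfl fun i _ => ?_
      rw [ip, ← intervalIntegral.integral_const_mul]
      congr 1; ext y; simp only [hc]; ring
    · intro i hi
      have := (M.hat_memS (Finset.mem_range.1 hi)).cont
      refine ContinuousOn.intervalIntegrable ?_
      rw [uIcc_of_le zero_le_one]
      fun_prop
  have hv' := hv.cont
  have hχ' := hχ.cont
  rw [h1, ip, M.integral_eq_sum (fun j hj => M.intervalIntegrable_elem (by fun_prop) hj),
    M.integral_eq_sum (fun j hj => M.intervalIntegrable_elem (by fun_prop) hj),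
    ← Finset.sum_add_distrib]
  refine Finset.sum_congr rfl fun j hj => ?_
  rw [Finset.mem_range] at hj
  rw [bubble, ← intervalIntegral.integral_const_mul, ← integral_add
    (M.intervalIntegrable_elem (by fun_prop) hj) (by apply Continuous.intervalIntegrable; fun_prop)]
  refine integral_congr fun y hy => ?_
  rw [uIcc_of_le (M.x_lt j hj).le] at hy
  simp only [M.interp_on_elem hc0 hj hy, hv.eq_on_elem hj hy, hχ.eq_on_elem hj hy]
  have hs := M.step_pos hj
  have e1 : v (M.x (j + 1)) = v (M.x j) + M.slope v j * M.step j := by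
    rw [M.slope_mul_step v hj]; ring
  have e2 : χ (M.x (j + 1)) = χ (M.x j) + M.slope χ j * M.step j := by
    rw [M.slope_mul_step χ hj]; ring
  have e3 : M.x (j + 1) = M.x j + M.step j := by rw [step]; ring
  simp only [hc, e1, e2]
  rw [e3]
  field_simp
  ring

lemma MemS.ip_self_le_lump (N : ℕ) {v : ℝ → ℝ} (hv : M.MemS v) : ip N v v ≤ M.lump N v v := by
  rw [hv.lump_eq N hv]
  have : 0 ≤ ∑ j ∈ Finset.range M.m, M.slope v j * M.slope v j * M.bubble N j :=
    Finset.sum_nonneg fun j hj =>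
      mul_nonneg (mul_self_nonneg _) (M.bubble_nonneg N (Finset.mem_range.1 hj))
  linarith

/-- A converse of `MemS.ip_self_le_lump` up to O(h²); it is needed for the initial error, whose
slopes are themselves O(h). -/
lemma MemS.lump_self_le (N : ℕ) {v : ℝ → ℝ} (hv : M.MemS v) {B : ℝ}
    (hB : ∀ j < M.m, |M.slope v j| ≤ B) : M.lump N v v ≤ ip N v v + B ^ 2 * M.h ^ 2 := by
  rw [hv.lump_eq N hv]
  have h1 : ∑ j ∈ Finset.range M.m, M.slope v j * M.slope v j * M.bubble N j
      ≤ ∑ j ∈ Finset.range M.m, B ^ 2 * M.h ^ 2 * M.weight N j := by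
    refine Finset.sum_le_sum fun j hj => ?_
    rw [Finset.mem_range] at hj
    rw [mul_assoc (B ^ 2)]
    refine mul_le_mul ?_ (M.bubble_le N hj) (M.bubble_nonneg N hj) (sq_nonneg _)
    rw [← sq]
    exact sq_le_sq' (by linarith [(_root_.abs_le.1 (hB j hj)).1]) (_root_.abs_le.1 (hB j hj)).2
  rw [← Finset.mul_sum] at h1
  nlinarith [M.sum_weight_le N, mul_nonneg (sq_nonneg B) (sq_nonneg M.h)]

/-- The lumping error against `χ` is absorbed by the Dirichlet form of `χ`. -/
lemma MemS.ip_sub_lump_le (N : ℕ) {v χ : ℝ → ℝ} (hv : M.MemS v) (hχ : M.MemS χ) {B : ℝ}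
    (hB : ∀ j < M.m, |M.slope v j| ≤ B) :
    ip N v χ - M.lump N v χ ≤ B ^ 2 * M.h ^ 4 + formA N χ χ := by
  rw [hv.lump_eq N hχ, hχ.formA_eq N hχ]
  have h1 : ∑ j ∈ Finset.range M.m, -(M.slope v j * M.slope χ j * M.bubble N j)
      ≤ ∑ j ∈ Finset.range M.m, (B ^ 2 * M.h ^ 4 * M.weight N j
        + M.slope χ j * M.slope χ j * M.weight N j) := by
    refine Finset.sum_le_sum fun j hj => ?_
    rw [Finset.mem_range] at hj
    have hw := (M.weight_pos N hj).le
    have hb := M.bubble_le N hj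
    have h2 := hB j hj
    have hB0 : 0 ≤ B := (abs_nonneg _).trans h2
    have hx := abs_nonneg (M.slope χ j)
    have h3 : |M.slope v j * M.slope χ j * M.bubble N j|
        ≤ B * |M.slope χ j| * (M.h ^ 2 * M.weight N j) := by
      rw [abs_mul, abs_mul, abs_of_nonneg (M.bubble_nonneg N hj)]
      gcongr
      exact M.bubble_nonneg N hj
    -- Young's inequality, with h² grouped with B so that the slope of χ appears with a coefficient
    -- free of h.
    have h4 : B * |M.slope χ j| * (M.h ^ 2 * M.weight N j)
        ≤ (B ^ 2 * M.h ^ 4 + M.slope χ j * M.slope χ j) * M.weight N j := by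
      rw [← abs_mul_abs_self (M.slope χ j), ← mul_assoc]
      refine mul_le_mul_of_nonneg_right ?_ hw
      nlinarith [sq_nonneg (B * M.h ^ 2 - |M.slope χ j|), mul_nonneg hB0 hx, sq_nonneg (B * M.h ^ 2),
        sq_nonneg (|M.slope χ j|)]
    have h5 := neg_abs_le (M.slope v j * M.slope χ j * M.bubble N j)
    linarith
  rw [Finset.sum_neg_distrib, Finset.sum_add_distrib, ← Finset.mul_sum] at h1
  have h6 : 0 ≤ B ^ 2 * M.h ^ 4 := by positivity
  nlinarith [M.sum_weight_le N]

/-! ### Discrete maximum principle. -/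

lemma lump_hat (N : ℕ) (v : ℝ → ℝ) {i : ℕ} (hi : i < M.m) :
    M.lump N v (M.hat i) = v (M.x i) * M.mass N i := by
  rw [lump, Finset.sum_eq_single i]
  · rw [M.hat_node hi hi.le, if_pos rfl, mul_one, mass]
  · intro k hk hki
    rw [M.hat_node hi (Finset.mem_range.1 hk).le, if_neg (Ne.symm hki), mul_zero, zero_mul]
  · intro h
    exact absurd (Finset.mem_range.2 hi) h

/-- Discrete maximum principle: the Dirichlet form against the hat function of a node where
`σ v` attains a nonnegative maximum has the sign of `σ`. -/
lemma MemS.mul_formA_hat_nonneg (N : ℕ) {v : ℝ → ℝ} (hv : M.MemS v) (σ : ℝ) {i : ℕ} (hi : i < M.m)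
    (hmax : ∀ k ≤ M.m, σ * v (M.x k) ≤ σ * v (M.x i)) : 0 ≤ σ * formA N v (M.hat i) := by
  rw [hv.formA_eq N (M.hat_memS hi), Finset.mul_sum]
  refine Finset.sum_nonneg fun j hj => ?_
  rw [Finset.mem_range] at hj
  rw [← mul_assoc]
  refine mul_nonneg ?_ (M.weight_pos N hj).le
  have hs := M.step_pos hj
  -- On an element touching x_i the product of slopes is v(x_i) minus the value at the other end,
  -- over the squared length; elsewhere the hat has slope zero.
  simp only [slope, M.hat_node hi hj.le, M.hat_node hi (show j + 1 ≤ M.m from hj)]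
  rw [div_mul_div_comm, ← mul_div_assoc]
  refine div_nonneg ?_ (by positivity)
  by_cases h1 : i = j + 1
  · subst h1
    rw [if_pos rfl, if_neg (by omega)]
    linarith [hmax j hj.le]
  · rw [if_neg h1]
    split_ifs with h2
    · subst h2
      linarith [hmax (i + 1) hj]
    · simp

end Mesh

/-! ### The elliptic projection. -/

lemma abs_le_sub_of_abs_le_succ {r φ : ℕ → ℝ} {k m : ℕ} (hm : r m = 0)
    (h : ∀ j, k ≤ j → j < m → |r j| ≤ |r (j + 1)| + (φ j - φ (j + 1))) {i : ℕ} (hki : k ≤ i)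
    (him : i ≤ m) : |r i| ≤ φ i - φ m := by
  obtain ⟨d, rfl⟩ := Nat.exists_eq_add_of_le him
  clear him
  induction d generalizing i with
  | zero => simp_all
  | succ d ih =>
    have h1 := h i hki (by omega)
    have h2 := ih (i := i + 1) (by omega) (by rw [← hm]; congr 1; omega)
      (fun j hj hj' => h j hj (by omega))
    rw [show i + 1 + d = i + (d + 1) by omega] at h2
    linarith

namespace Mesh

variable (M : Mesh) (N : ℕ)

/-- The weighted mean of `g` over the element `(x_j, x_{j+1})`. -/
noncomputable def avg (g : ℝ → ℝ) (j : ℕ) : ℝ :=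
  (∫ y in (M.x j)..(M.x (j + 1)), y ^ (N - 1) * g y) / M.weight N j

/-- The elliptic projection onto `S_h` of the function with derivative `g` that vanishes at `1`:
on each element its slope is the weighted mean of `g`. -/
noncomputable def proj (g : ℝ → ℝ) : ℝ → ℝ :=
  M.interp fun i => -∑ j ∈ Finset.Ico i M.m, M.step j * M.avg N g j

lemma proj_memS (g : ℝ → ℝ) : M.MemS (M.proj N g) := M.interp_memS (by simp)

lemma proj_node (g : ℝ → ℝ) {i : ℕ} (hi : i ≤ M.m) :
    M.proj N g (M.x i) = -∑ j ∈ Finset.Ico i M.m, M.step j * M.avg N g j :=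
  M.interp_node (by simp) hi

lemma slope_proj (g : ℝ → ℝ) {j : ℕ} (hj : j < M.m) : M.slope (M.proj N g) j = M.avg N g j := by
  rw [slope, M.proj_node N g hj.le, M.proj_node N g hj, Finset.sum_eq_sum_Ico_succ_bot hj,
    div_eq_iff (M.step_pos hj).ne']
  ring

variable {M N}

lemma avg_sub_div {g₁ g₂ : ℝ → ℝ} (h₁ : ContinuousOn g₁ (Icc 0 1)) (h₂ : ContinuousOn g₂ (Icc 0 1))
    (c : ℝ) {j : ℕ} (hj : j < M.m) :
    M.avg N (fun y => (g₁ y - g₂ y) / c) j = (M.avg N g₁ j - M.avg N g₂ j) / c := by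
  have e : (fun y => y ^ (N - 1) * ((g₁ y - g₂ y) / c))
      = fun y => (y ^ (N - 1) * g₁ y - y ^ (N - 1) * g₂ y) / c := by
    ext y; ring
  rw [avg, avg, avg, e, intervalIntegral.integral_div, intervalIntegral.integral_sub
    (M.intervalIntegrable_elem (by fun_prop) hj) (M.intervalIntegrable_elem (by fun_prop) hj)]
  ring

/-- Projection commutes with difference quotients in time, so the projection estimates apply
directly to the discrete time derivative. -/
lemma proj_sub_div {g₁ g₂ : ℝ → ℝ} (h₁ : ContinuousOn g₁ (Icc 0 1))
    (h₂ : ContinuousOn g₂ (Icc 0 1)) (c y : ℝ) :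
    M.proj N (fun y => (g₁ y - g₂ y) / c) y = (M.proj N g₁ y - M.proj N g₂ y) / c := by
  simp only [proj, interp]
  rw [← Finset.sum_sub_distrib, Finset.sum_div]
  refine Finset.sum_congr rfl fun i _ => ?_
  have : ∑ j ∈ Finset.Ico i M.m, M.step j * M.avg N (fun y => (g₁ y - g₂ y) / c) j
      = (∑ j ∈ Finset.Ico i M.m, M.step j * M.avg N g₁ j
        - ∑ j ∈ Finset.Ico i M.m, M.step j * M.avg N g₂ j) / c := by
    rw [← Finset.sum_sub_distrib, Finset.sum_div]
    refine Finset.sum_congr rfl fun j hj => ?_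
    rw [avg_sub_div h₁ h₂ c (Finset.mem_Ico.1 hj).2]
    ring
  rw [this]
  ring

/-- Used with c = g(y) for accuracy of the slopes and with c = 0 for their boundedness. -/
lemma abs_avg_sub_le {g : ℝ → ℝ} (hg : ContinuousOn g (Icc 0 1)) {j : ℕ} (hj : j < M.m) {c B : ℝ}
    (h : ∀ z ∈ Icc (M.x j) (M.x (j + 1)), |g z - c| ≤ B) : |M.avg N g j - c| ≤ B := by
  have hw := M.weight_pos N hj
  have hi : IntervalIntegrable (fun y => y ^ (N - 1) * g y) volume (M.x j) (M.x (j + 1)) :=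
    M.intervalIntegrable_elem (by fun_prop) hj
  have hc : ∀ d : ℝ, IntervalIntegrable (fun y : ℝ => y ^ (N - 1) * d) volume
      (M.x j) (M.x (j + 1)) := fun d => by apply Continuous.intervalIntegrable; fun_prop
  have hp : ∀ z ∈ Icc (M.x j) (M.x (j + 1)), 0 ≤ z ^ (N - 1) := fun z hz =>
    pow_nonneg ((M.x_nonneg hj.le).trans hz.1) _
  have h1 := integral_mono_on (M.x_lt j hj).le hi (hc (c + B)) fun z hz =>
    mul_le_mul_of_nonneg_left (by linarith [(_root_.abs_le.1 (h z hz)).2]) (hp z hz)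
  have h2 := integral_mono_on (M.x_lt j hj).le (hc (c - B)) hi fun z hz =>
    mul_le_mul_of_nonneg_left (by linarith [(_root_.abs_le.1 (h z hz)).1]) (hp z hz)
  rw [intervalIntegral.integral_mul_const, ← weight] at h1 h2
  have h3 : M.avg N g j ≤ c + B := by rw [avg, div_le_iff₀ hw]; linarith
  have h4 : c - B ≤ M.avg N g j := by rw [avg, le_div_iff₀ hw]; linarith
  rw [_root_.abs_le]
  constructor <;> linarith

lemma MemS.formA_proj {g χ : ℝ → ℝ} (hχ : M.MemS χ) :
    formA N (M.proj N g) χ = ∑ j ∈ Finset.range M.m,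
      M.slope χ j * ∫ y in (M.x j)..(M.x (j + 1)), y ^ (N - 1) * g y := by
  rw [(M.proj_memS N g).formA_eq N hχ]
  refine Finset.sum_congr rfl fun j hj => ?_
  rw [Finset.mem_range] at hj
  have hw := (M.weight_pos N hj).ne'
  rw [M.slope_proj N g hj, avg]
  field_simp

/-- The elliptic projection satisfies the weak form of `x^{1-N} (x^{N-1} g)' = F`. -/
lemma MemS.formA_proj_eq {g F χ : ℝ → ℝ} (hN : 2 ≤ N) (hχ : M.MemS χ)
    (hg : ContinuousOn g (Icc 0 1)) (hF : ContinuousOn F (Icc 0 1))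
    (h : ∀ z ∈ Ioo (0 : ℝ) 1,
      HasDerivAt (fun z => z ^ (N - 1) * g z) (z ^ (N - 1) * F z) z) :
    formA N (M.proj N g) χ = -ip N F χ := by
  have hχ' := hχ.cont
  rw [hχ.formA_proj, ip, M.integral_eq_sum
    (fun j hj => M.intervalIntegrable_elem (by fun_prop) hj)]
  -- Integration by parts on one element, where χ' is the constant slope.
  have key : ∀ j ∈ Finset.range M.m,
      M.slope χ j * (∫ y in (M.x j)..(M.x (j + 1)), y ^ (N - 1) * g y)
      + (∫ y in (M.x j)..(M.x (j + 1)), y ^ (N - 1) * (F y * χ y))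
      = (M.x (j + 1) ^ (N - 1) * g (M.x (j + 1))) * χ (M.x (j + 1))
        - (M.x j ^ (N - 1) * g (M.x j)) * χ (M.x j) := by
    intro j hj
    rw [Finset.mem_range] at hj
    have hsub := M.elem_subset hj
    have hcont : ContinuousOn (fun z => (z ^ (N - 1) * g z) * χ z) (Icc 0 1) := by fun_prop
    rw [← integral_eq_sub_of_hasDerivAt_of_le (M.x_lt j hj).le
      (f := fun z => (z ^ (N - 1) * g z) * χ z)
      (f' := fun z => M.slope χ j * (z ^ (N - 1) * g z) + z ^ (N - 1) * (F z * χ z))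
      (hcont.mono hsub)]
    · rw [intervalIntegral.integral_add (M.intervalIntegrable_elem (by fun_prop) hj)
        (M.intervalIntegrable_elem (by fun_prop) hj), intervalIntegral.integral_const_mul]
    · intro z hz
      have hz' : z ∈ Ioo (0 : ℝ) 1 :=
        ⟨(M.x_nonneg hj.le).trans_lt hz.1, hz.2.trans_le (M.x_le_one hj)⟩
      convert! (h z hz').mul (hχ.hasDerivAt hj hz) using 1
      ring
    · exact M.intervalIntegrable_elem (by fun_prop) hj
  have hsum := Finset.sum_congr (rfl : Finset.range M.m = Finset.range M.m) key
  -- The boundary terms telescope: χ(1) = 0 at the right end, and at the origin the weight 0^{N-1}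
  -- vanishes since N ≥ 2.
  rw [Finset.sum_add_distrib,
    Finset.sum_range_sub (fun j => (M.x j ^ (N - 1) * g (M.x j)) * χ (M.x j)), M.x_last, hχ.right,
    M.x_zero, zero_pow (by omega)] at hsum
  linarith

/-! ### Error of the elliptic projection. -/

section error

variable {w g : ℝ → ℝ} {K : ℝ}

lemma abs_avg_sub_le_mul_h (hg : ContinuousOn g (Icc 0 1)) (hK : 0 ≤ K)
    (hL : ∀ a ∈ Icc (0 : ℝ) 1, ∀ b ∈ Icc (0 : ℝ) 1, |g a - g b| ≤ K * |a - b|) {j : ℕ}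
    (hj : j < M.m) {y : ℝ} (hy : y ∈ Icc (M.x j) (M.x (j + 1))) :
    |M.avg N g j - g y| ≤ K * M.h := by
  refine abs_avg_sub_le hg hj fun z hz => ?_
  refine (hL z (M.elem_subset hj hz) y (M.elem_subset hj hy)).trans ?_
  refine mul_le_mul_of_nonneg_left (le_trans ?_ (M.step_le_h hj)) hK
  rw [step, _root_.abs_le]
  constructor <;> linarith [hy.1, hy.2, hz.1, hz.2]

/-- The error is compared with its value at the right node because it is known to vanish only at x =
1, and estimates must propagate from there. -/
lemma proj_sub_eq (hg : ContinuousOn g (Icc 0 1))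
    (hw : ∀ y ∈ Icc (0 : ℝ) 1, HasDerivWithinAt w (g y) (Icc 0 1) y) {j : ℕ}
    (hj : j < M.m) {y : ℝ} (hy : y ∈ Icc (M.x j) (M.x (j + 1))) :
    (M.proj N g y - w y) - (M.proj N g (M.x (j + 1)) - w (M.x (j + 1)))
      = ∫ z in y..(M.x (j + 1)), (g z - M.avg N g j) := by
  have hsub : Icc y (M.x (j + 1)) ⊆ Icc 0 1 :=
    (Icc_subset_Icc_left hy.1).trans (M.elem_subset hj)
  have hcw : ContinuousOn w (Icc 0 1) := fun z hz => (hw z hz).continuousWithinAt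
  have hint : IntervalIntegrable g volume y (M.x (j + 1)) := by
    refine ContinuousOn.intervalIntegrable ?_
    rw [uIcc_of_le hy.2]
    exact hg.mono hsub
  rw [intervalIntegral.integral_sub hint (by simp), integral_eq_sub_of_hasDerivAt_of_le (f := w) hy.2
    (hcw.mono hsub) (fun z hz => ?_) hint, intervalIntegral.integral_const,
    (M.proj_memS N g).eq_on_elem hj hy, (M.proj_memS N g).eq_on_elem hj
      (right_mem_Icc.2 (M.x_lt j hj).le), M.slope_proj N g hj, smul_eq_mul]
  · ring
  · have hz' := hsub (Ioo_subset_Icc_self hz)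
    refine (hw z hz').hasDerivAt (Icc_mem_nhds ?_ ?_)
    · exact ((M.x_nonneg hj.le).trans hy.1).trans_lt hz.1
    · exact hz.2.trans_le (M.x_le_one hj)

lemma abs_proj_sub_sub_le (hg : ContinuousOn g (Icc 0 1)) (hK : 0 ≤ K)
    (hL : ∀ a ∈ Icc (0 : ℝ) 1, ∀ b ∈ Icc (0 : ℝ) 1, |g a - g b| ≤ K * |a - b|)
    (hw : ∀ y ∈ Icc (0 : ℝ) 1, HasDerivWithinAt w (g y) (Icc 0 1) y) {j : ℕ}
    (hj : j < M.m) {y : ℝ} (hy : y ∈ Icc (M.x j) (M.x (j + 1))) :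
    |(M.proj N g y - w y) - (M.proj N g (M.x (j + 1)) - w (M.x (j + 1)))|
      ≤ K * M.h * (M.x (j + 1) - y) := by
  rw [proj_sub_eq hg hw hj hy]
  have := norm_integral_le_of_norm_le_const (a := y) (b := M.x (j + 1))
    (f := fun z => g z - M.avg N g j) (C := K * M.h) fun z hz => by
      rw [uIoc_of_le hy.2] at hz
      rw [Real.norm_eq_abs, abs_sub_comm]
      exact abs_avg_sub_le_mul_h hg hK hL hj ⟨hy.1.trans hz.1.le, hz.2⟩
  rwa [Real.norm_eq_abs, abs_of_nonneg (by linarith [hy.2] : 0 ≤ M.x (j + 1) - y)] at this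

/-- Crude maximum norm estimate for the elliptic projection. -/
lemma abs_proj_sub_le (hg : ContinuousOn g (Icc 0 1)) (hK : 0 ≤ K)
    (hL : ∀ a ∈ Icc (0 : ℝ) 1, ∀ b ∈ Icc (0 : ℝ) 1, |g a - g b| ≤ K * |a - b|)
    (hw : ∀ y ∈ Icc (0 : ℝ) 1, HasDerivWithinAt w (g y) (Icc 0 1) y) (hw1 : w 1 = 0) {y : ℝ}
    (hy : y ∈ Icc (0 : ℝ) 1) : |M.proj N g y - w y| ≤ K * M.h := by
  have hKh : 0 ≤ K * M.h := mul_nonneg hK M.h_pos.le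
  have hlast : M.proj N g (M.x M.m) - w (M.x M.m) = 0 := by
    rw [M.x_last, (M.proj_memS N g).right, hw1, sub_zero]
  have hnode : ∀ i ≤ M.m, |M.proj N g (M.x i) - w (M.x i)| ≤ K * M.h * (1 - M.x i) := by
    intro i hi
    have := abs_le_sub_of_abs_le_succ (r := fun i => M.proj N g (M.x i) - w (M.x i))
      (φ := fun i => -(K * M.h * M.x i)) (k := 0) (m := M.m) hlast (fun j _ hj => by
        have h1 := abs_proj_sub_sub_le (N := N) hg hK hL hw hj (left_mem_Icc.2 (M.x_lt j hj).le)
        have h2 := abs_sub_abs_le_abs_sub (M.proj N g (M.x j) - w (M.x j))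
          (M.proj N g (M.x (j + 1)) - w (M.x (j + 1)))
        linarith) (Nat.zero_le i) hi
    simp only [M.x_last] at this
    linarith
  obtain ⟨j, hj, hyj⟩ := M.exists_elem hy
  have h1 := abs_proj_sub_sub_le (N := N) hg hK hL hw hj hyj
  have h2 := abs_sub_abs_le_abs_sub (M.proj N g y - w y)
    (M.proj N g (M.x (j + 1)) - w (M.x (j + 1)))
  have h3 := hnode (j + 1) hj
  nlinarith [hy.1]

/-- Over a whole element g minus its weighted mean integrates to zero against z^{N-1}. Subtracting a
multiple of this identity leaves the factor 1 - (z/x_{j+1})^{N-1}, which is O(h/x_{j+1}) and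
supplies a second power of h. -/
lemma abs_proj_sub_node_sub_le (hN : 2 ≤ N) (hg : ContinuousOn g (Icc 0 1)) (hK : 0 ≤ K)
    (hL : ∀ a ∈ Icc (0 : ℝ) 1, ∀ b ∈ Icc (0 : ℝ) 1, |g a - g b| ≤ K * |a - b|)
    (hw : ∀ y ∈ Icc (0 : ℝ) 1, HasDerivWithinAt w (g y) (Icc 0 1) y) {j : ℕ}
    (hj : j < M.m) :
    |(M.proj N g (M.x j) - w (M.x j)) - (M.proj N g (M.x (j + 1)) - w (M.x (j + 1)))|
      ≤ (N - 1) * K * M.h ^ 2 * (M.step j / M.x (j + 1)) := by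
  have hlt := M.x_lt j hj
  have hb : 0 < M.x (j + 1) := (M.x_nonneg hj.le).trans_lt hlt
  have hW := (M.weight_pos N hj).ne'
  rw [proj_sub_eq hg hw hj (left_mem_Icc.2 hlt.le)]
  have hN1 : ((N - 1 : ℕ) : ℝ) = N - 1 := by rw [Nat.cast_sub (by omega), Nat.cast_one]
  have hi : IntervalIntegrable (fun y => y ^ (N - 1) * g y) volume (M.x j) (M.x (j + 1)) :=
    M.intervalIntegrable_elem (by fun_prop) hj
  have hi' : IntervalIntegrable (fun y : ℝ => y ^ (N - 1) * M.avg N g j) volume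
    (M.x j) (M.x (j + 1)) := by apply Continuous.intervalIntegrable; fun_prop
  have hzero : ∫ z in (M.x j)..(M.x (j + 1)), (z ^ (N - 1) * g z - z ^ (N - 1) * M.avg N g j)
      = 0 := by
    rw [intervalIntegral.integral_sub hi hi', intervalIntegral.integral_mul_const, ← weight, avg]
    field_simp
    ring
  have hrew : ∫ z in (M.x j)..(M.x (j + 1)), (g z - M.avg N g j)
      = ∫ z in (M.x j)..(M.x (j + 1)),
        (1 - (z / M.x (j + 1)) ^ (N - 1)) * (g z - M.avg N g j) := by
    have e : (fun z => (1 - (z / M.x (j + 1)) ^ (N - 1)) * (g z - M.avg N g j))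
        = fun z => (g z - M.avg N g j) - (1 / M.x (j + 1) ^ (N - 1))
          * (z ^ (N - 1) * g z - z ^ (N - 1) * M.avg N g j) := by
      ext z; rw [div_pow]; ring
    rw [e, intervalIntegral.integral_sub (M.intervalIntegrable_elem (by fun_prop) hj)
      ((hi.sub hi').const_mul _), intervalIntegral.integral_const_mul, hzero]
    ring
  rw [hrew]
  have := norm_integral_le_of_norm_le_const (a := M.x j) (b := M.x (j + 1))
    (f := fun z => (1 - (z / M.x (j + 1)) ^ (N - 1)) * (g z - M.avg N g j))
    (C := ((N - 1) * (M.h / M.x (j + 1))) * (K * M.h)) fun z hz => by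
      rw [uIoc_of_le hlt.le] at hz
      have hz0 : 0 ≤ z := (M.x_nonneg hj.le).trans hz.1.le
      have hr1 : z / M.x (j + 1) ≤ 1 := (div_le_one hb).2 hz.2
      have hr0 : 0 ≤ z / M.x (j + 1) := div_nonneg hz0 hb.le
      rw [Real.norm_eq_abs, abs_mul]
      have hs := M.step_le_h hj
      rw [step] at hs
      refine mul_le_mul ?_ ?_ (abs_nonneg _) ?_
      · rw [abs_of_nonneg (sub_nonneg.2 (pow_le_one₀ hr0 hr1))]
        -- Bernoulli's inequality: 1 - s^{N-1} ≤ (N-1)(1 - s).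
        have hB := one_add_mul_le_pow (a := z / M.x (j + 1) - 1) (by linarith) (N - 1)
        rw [hN1, add_sub_cancel] at hB
        have h1 : 1 - z / M.x (j + 1) ≤ M.h / M.x (j + 1) := by
          rw [sub_le_iff_le_add, ← add_div, le_div_iff₀ hb]
          linarith [hz.1]
        have h2 : (0 : ℝ) ≤ N - 1 := by rw [← hN1]; positivity
        nlinarith
      · rw [abs_sub_comm]
        exact abs_avg_sub_le_mul_h hg hK hL hj ⟨hz.1.le, hz.2⟩
      · rw [← hN1]
        have := M.h_pos
        positivity
  rw [Real.norm_eq_abs, abs_of_nonneg (by linarith : 0 ≤ M.x (j + 1) - M.x j)] at this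
  refine this.trans (le_of_eq ?_)
  rw [step]
  ring

/-- The left side is at most ∫_a^b dx/x, hence at most ∫_a^b x^{-3/2} dx because x ≤ 1. The
telescoping majorant 2/√x replaces a logarithm. -/
lemma sub_div_le_sqrt {a b : ℝ} (ha : 0 < a) (hab : a ≤ b) (hb : b ≤ 1) :
    (b - a) / b ≤ 2 / √a - 2 / √b := by
  have hb0 := ha.trans_le hab
  set p := √a with hp
  set q := √b with hq
  have hp0 : 0 < p := Real.sqrt_pos.2 ha
  have hq0 : 0 < q := Real.sqrt_pos.2 hb0
  have ea : a = p ^ 2 := (Real.sq_sqrt ha.le).symm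
  have eb : b = q ^ 2 := (Real.sq_sqrt hb0.le).symm
  have hpq : p ≤ q := Real.sqrt_le_sqrt hab
  have hp1 : p ≤ 1 := Real.sqrt_le_one.2 (hab.trans hb)
  rw [div_sub_div _ _ hp0.ne' hq0.ne', div_le_div_iff₀ hb0 (by positivity), ea, eb]
  have h1 : (p + q) * p ≤ 2 * q := by nlinarith
  have h2 : 0 ≤ q * (q - p) := mul_nonneg hq0.le (sub_nonneg.2 hpq)
  nlinarith [mul_le_mul_of_nonneg_left h1 h2]

/-- Weighted pointwise estimate for the elliptic projection, of optimal order. -/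
lemma weighted_proj_sub_sq_le (hN : 2 ≤ N) (hg : ContinuousOn g (Icc 0 1)) (hK : 0 ≤ K)
    (hL : ∀ a ∈ Icc (0 : ℝ) 1, ∀ b ∈ Icc (0 : ℝ) 1, |g a - g b| ≤ K * |a - b|)
    (hw : ∀ y ∈ Icc (0 : ℝ) 1, HasDerivWithinAt w (g y) (Icc 0 1) y) (hw1 : w 1 = 0) {y : ℝ}
    (hy : y ∈ Icc (0 : ℝ) 1) :
    y * (M.proj N g y - w y) ^ 2 ≤ (2 * N * K * M.h ^ 2) ^ 2 := by
  have hlast : M.proj N g (M.x M.m) - w (M.x M.m) = 0 := by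
    rw [M.x_last, (M.proj_memS N g).right, hw1, sub_zero]
  set A : ℝ := (N - 1) * K * M.h ^ 2 with hA
  have hN2 : (2 : ℝ) ≤ N := by exact_mod_cast hN
  have hA0 : 0 ≤ A := mul_nonneg (mul_nonneg (by linarith) hK) (sq_nonneg _)
  -- The chain stops at x_1, since 2/√x is singular at x_0 = 0; points of the first element are
  -- reached from x_1.
  have hnode : ∀ i, 1 ≤ i → i ≤ M.m →
      |M.proj N g (M.x i) - w (M.x i)| ≤ A * (2 / √(M.x i)) := by
    intro i hi1 hi
    have := abs_le_sub_of_abs_le_succ (r := fun i => M.proj N g (M.x i) - w (M.x i))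
      (φ := fun i => A * (2 / √(M.x i))) (k := 1) (m := M.m) hlast (fun j hj1 hj => by
        have h1 := abs_proj_sub_node_sub_le (N := N) hN hg hK hL hw hj
        have h2 := abs_sub_abs_le_abs_sub (M.proj N g (M.x j) - w (M.x j))
          (M.proj N g (M.x (j + 1)) - w (M.x (j + 1)))
        have h0 : 0 < M.x j := by
          have h3 := M.x_lt 0 M.m_pos
          rw [M.x_zero] at h3
          exact h3.trans_le (M.x_mono hj1 hj.le)
        have h4 := mul_le_mul_of_nonneg_left
          (sub_div_le_sqrt h0 (M.x_lt j hj).le (M.x_le_one hj)) hA0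
        rw [mul_sub, ← step] at h4
        linarith) hi1 hi
    have h5 : 0 ≤ A * (2 / √(M.x M.m)) := by positivity
    linarith
  obtain ⟨j, hj, hyj⟩ := M.exists_elem hy
  have hb : 0 < M.x (j + 1) := (M.x_nonneg hj.le).trans_lt (M.x_lt j hj)
  have h1 := abs_proj_sub_sub_le (N := N) hg hK hL hw hj hyj
  have h2 := abs_sub_abs_le_abs_sub (M.proj N g y - w y)
    (M.proj N g (M.x (j + 1)) - w (M.x (j + 1)))
  have h3 := hnode (j + 1) (by omega) hj
  have hh := M.step_le_h hj
  rw [step] at hh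
  have hKh : 0 ≤ K * M.h := mul_nonneg hK M.h_pos.le
  have h4 : K * M.h * (M.x (j + 1) - y) ≤ K * M.h ^ 2 := by
    rw [sq, ← mul_assoc]
    exact mul_le_mul_of_nonneg_left (by linarith [hyj.1]) hKh
  have h5 : |M.proj N g y - w y| ≤ A * (2 / √(M.x (j + 1))) + K * M.h ^ 2 := by linarith
  have hs0 : 0 < √(M.x (j + 1)) := Real.sqrt_pos.2 hb
  have hsy : √y ≤ √(M.x (j + 1)) := Real.sqrt_le_sqrt hyj.2
  have hs1 : √y ≤ 1 := Real.sqrt_le_one.2 hy.2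
  have hs := Real.sqrt_nonneg y
  have hKh2 : 0 ≤ K * M.h ^ 2 := mul_nonneg hK (sq_nonneg _)
  -- The singular bound sits at the right node, so √y/√x_{j+1} ≤ 1. The constant uses 2(N-1) + 1 ≤
  -- 2N.
  have h6 : √y * |M.proj N g y - w y| ≤ 2 * N * K * M.h ^ 2 := by
    calc √y * |M.proj N g y - w y| ≤ √y * (A * (2 / √(M.x (j + 1))) + K * M.h ^ 2) :=
          mul_le_mul_of_nonneg_left h5 hs
      _ = 2 * A * (√y / √(M.x (j + 1))) + √y * (K * M.h ^ 2) := by ring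
      _ ≤ 2 * A * 1 + 1 * (K * M.h ^ 2) := by
          gcongr
          exact (div_le_one hs0).2 hsy
      _ ≤ 2 * N * K * M.h ^ 2 := by rw [hA]; nlinarith
  have h7 : y * (M.proj N g y - w y) ^ 2 = (√y * |M.proj N g y - w y|) ^ 2 := by
    rw [mul_pow, Real.sq_sqrt hy.1, sq_abs]
  rw [h7]
  exact pow_le_pow_left₀ (mul_nonneg hs (abs_nonneg _)) h6 2

end error

end Mesh

/-! ### Stability of one step of the lumped scheme. -/

namespace Mesh

variable {M : Mesh} {N : ℕ} {θ θ' E W : ℝ → ℝ} {τ : ℝ}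

/-- One step of the lumped implicit scheme is stable in the maximum norm. -/
lemma MemS.abs_step_le (hθ' : M.MemS θ') (hE : ContinuousOn E (Icc 0 1)) (hτ : 0 < τ)
    (H : ∀ χ, M.MemS χ → M.lump N (fun y => (θ' y - θ y) / τ) χ + formA N θ' χ
      = ip N E χ - M.lump N W χ)
    {Θ B : ℝ} (hB : 0 ≤ B) (hΘ : ∀ i ≤ M.m, |θ (M.x i)| ≤ Θ)
    (hEW : ∀ i < M.m, ∀ y ∈ Icc (0 : ℝ) 1, M.hat i y ≠ 0 → |E y - W (M.x i)| ≤ B) :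
    ∀ k ≤ M.m, |θ' (M.x k)| ≤ Θ + τ * B := by
  have hΘ0 : 0 ≤ Θ := (abs_nonneg _).trans (hΘ 0 (Nat.zero_le _))
  have hτB : 0 ≤ τ * B := mul_nonneg hτ.le hB
  -- σ = ±1 handles the maximum and the minimum together.
  have key : ∀ σ : ℝ, |σ| = 1 → ∀ k ≤ M.m, σ * θ' (M.x k) ≤ Θ + τ * B := by
    intro σ hσ k hk
    obtain ⟨i, hi, hmax⟩ := Finset.exists_max_image (Finset.range (M.m + 1))
      (fun k => σ * θ' (M.x k)) ⟨0, by simp⟩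
    have hi' : i ≤ M.m := by rw [Finset.mem_range] at hi; omega
    have hmax' : ∀ k ≤ M.m, σ * θ' (M.x k) ≤ σ * θ' (M.x i) := fun k hk =>
      hmax k (Finset.mem_range.2 (by omega))
    refine (hmax' k hk).trans ?_
    -- If the extremum is at x = 1 it is zero. Otherwise testing with the hat at that node isolates
    -- the nodal value, and the Dirichlet term has a favourable sign.
    rcases eq_or_lt_of_le hi' with h | h
    · rw [h, M.x_last, hθ'.right, mul_zero]
      linarith
    · have hA := hθ'.mul_formA_hat_nonneg N σ h hmax'
      have hH := H _ (M.hat_memS h)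
      have hc := (M.hat_memS h).cont
      have hmu := M.mass_pos N h
      rw [lump_hat N _ h, lump_hat N _ h] at hH
      have e1 : ip N E (M.hat i) - W (M.x i) * M.mass N i
          = ip N (fun y => E y - W (M.x i)) (M.hat i) := by
        rw [ip_sub hE continuousOn_const hc, mass, ← ip_const_mul]
        simp only [mul_one]
      have h2 : σ * ip N (fun y => E y - W (M.x i)) (M.hat i) ≤ B * M.mass N i := by
        rw [mass, ← ip_const_mul, ← ip_const_mul]
        refine ip_mono (by fun_prop) hc (by fun_prop) hc fun y hy => ?_
        rcases eq_or_ne (M.hat i y) 0 with h0 | h0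
        · simp [h0]
        · refine mul_le_mul_of_nonneg_right ?_ (M.hat_nonneg h hy)
          calc σ * (E y - W (M.x i)) ≤ |σ * (E y - W (M.x i))| := le_abs_self _
            _ = |E y - W (M.x i)| := by rw [abs_mul, hσ, one_mul]
            _ ≤ B * 1 := by rw [mul_one]; exact hEW i h y hy h0
      rw [e1] at hH
      have h3 : σ * ((θ' (M.x i) - θ (M.x i)) / τ) * M.mass N i ≤ B * M.mass N i := by
        have : σ * ((θ' (M.x i) - θ (M.x i)) / τ) * M.mass N i
          = σ * ip N (fun y => E y - W (M.x i)) (M.hat i) - σ * formA N θ' (M.hat i) := by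
          rw [← hH]; ring
        linarith
      have h4 := le_of_mul_le_mul_right h3 hmu
      rw [← mul_div_assoc, div_le_iff₀ hτ] at h4
      have h5 : σ * θ (M.x i) ≤ Θ :=
        (le_abs_self _).trans (by rw [abs_mul, hσ, one_mul]; exact hΘ i hi')
      linarith
  intro k hk
  rw [_root_.abs_le]
  have h1 := key 1 (by simp) k hk
  have h2 := key (-1) (by simp) k hk
  constructor <;> linarith

/-- Energy estimate for one step of the lumped implicit scheme. -/
lemma MemS.lump_step_le (hθ' : M.MemS θ') (hE : ContinuousOn E (Icc 0 1)) (hW : M.MemS W)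
    (hτ : 0 < τ)
    (H : ∀ χ, M.MemS χ → M.lump N (fun y => (θ' y - θ y) / τ) χ + formA N θ' χ
      = ip N E χ - M.lump N W χ)
    {B : ℝ} (hB : ∀ j < M.m, |M.slope W j| ≤ B) :
    (1 - τ) * M.lump N θ' θ' ≤ M.lump N θ θ
      + τ * (ip N (fun y => E y - W y) (fun y => E y - W y) + 2 * (B ^ 2 * M.h ^ 4)) := by
  have hW' := hW.cont
  have hθc := hθ'.cont
  have hH := H θ' hθ'
  have h1 := hW.ip_sub_lump_le N hθ' hB
  have h2 := hθ'.ip_self_le_lump N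
  -- Nodewise a² - b² ≤ 2(a - b)a, with nonnegative masses.
  have h3 : M.lump N θ' θ' - M.lump N θ θ
      ≤ 2 * τ * M.lump N (fun y => (θ' y - θ y) / τ) θ' := by
    simp only [lump]
    rw [← Finset.sum_sub_distrib, Finset.mul_sum]
    refine Finset.sum_le_sum fun i hi => ?_
    have hm := M.mass_nonneg N (Finset.mem_range.1 hi)
    rw [mass] at hm
    have e : 2 * τ * ((θ' (M.x i) - θ (M.x i)) / τ * θ' (M.x i) * ip N (fun _ => 1) (M.hat i))
        = 2 * (θ' (M.x i) - θ (M.x i)) * θ' (M.x i) * ip N (fun _ => 1) (M.hat i) := by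
      field_simp
    rw [e, ← sub_mul]
    refine mul_le_mul_of_nonneg_right ?_ hm
    nlinarith [sq_nonneg (θ' (M.x i) - θ (M.x i))]
  have h4 := ip_sub (N := N) hE hW' hθc
  have h5 : 2 * ip N (fun y => E y - W y) θ'
      ≤ ip N (fun y => E y - W y) (fun y => E y - W y) + ip N θ' θ' := by
    have e1 : ip N (fun y => E y - W y) (fun y => E y - W y) + ip N θ' θ'
        = ip N (fun y => (E y - W y) * (E y - W y) + θ' y * θ' y) (fun _ => 1) := by
      rw [ip_add (by fun_prop) (by fun_prop) continuousOn_const]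
      congr 1 <;> exact ip_congr fun y _ => by ring
    rw [e1, ← ip_const_mul]
    refine ip_mono (by fun_prop) hθc (by fun_prop) continuousOn_const fun y _ => ?_
    nlinarith [sq_nonneg (E y - W y - θ' y)]
  -- The Dirichlet term from the scheme cancels the one produced by the lumping error `h1`.
  have h6 : 2 * M.lump N (fun y => (θ' y - θ y) / τ) θ'
      ≤ ip N (fun y => E y - W y) (fun y => E y - W y) + M.lump N θ' θ'
        + 2 * (B ^ 2 * M.h ^ 4) := by
    linarith
  nlinarith [mul_le_mul_of_nonneg_left h6 hτ.le]

lemma slope_sub {v w : ℝ → ℝ} (j : ℕ) :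
    M.slope (fun y => v y - w y) j = M.slope v j - M.slope w j := by
  simp only [slope]; ring

lemma MemS.formA_sub {v w χ : ℝ → ℝ} (hv : M.MemS v) (hw : M.MemS w) (hχ : M.MemS χ) :
    formA N (fun y => v y - w y) χ = formA N v χ - formA N w χ := by
  rw [(hv.sub hw).formA_eq N hχ, hv.formA_eq N hχ, hw.formA_eq N hχ, ← Finset.sum_sub_distrib]
  refine Finset.sum_congr rfl fun j _ => ?_
  rw [slope_sub]
  ring

end Mesh

/-! ### Bounds for the exact solution, and a Gronwall step. -/

section maxNorm

lemma abs_le_maxNorm {α : Type*} [TopologicalSpace α] {s : Set α} (hs : IsCompact s) {v : α → ℝ}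
    (hv : ContinuousOn v s) {p : α} (hp : p ∈ s) : |v p| ≤ maxNorm s v :=
  le_csSup (hs.image_of_continuousOn hv.abs).bddAbove ⟨p, hp, rfl⟩

lemma maxNorm_nonneg {α : Type*} (s : Set α) (v : α → ℝ) : 0 ≤ maxNorm s v := by
  refine Real.sSup_nonneg ?_
  rintro _ ⟨p, _, rfl⟩
  exact abs_nonneg _

lemma isCompact_cylinder (T : ℝ) : IsCompact (cylinder T) := isCompact_Icc.prod isCompact_Icc

end maxNorm

variable {T K : ℝ} {u v : ℝ × ℝ → ℝ}

/-- All the derivatives in `κ(u)` are bounded by `K` on `Q_T`. -/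
lemma IsSmooth.abs_le (hu : IsSmooth T u) (hK : kappa T u ≤ K) {p : ℝ × ℝ} (hp : p ∈ cylinder T) :
    |u p| ≤ K ∧ |dx u p| ≤ K ∧ |dx (dx u) p| ≤ K ∧ |dt T u p| ≤ K ∧ |dt T (dt T u) p| ≤ K ∧
      |dt T (dx u) p| ≤ K ∧ |dt T (dx (dx u)) p| ≤ K := by
  have hc := isCompact_cylinder T
  have h1 := abs_le_maxNorm hc hu.cont hp
  have h2 := abs_le_maxNorm hc hu.u_x.2 hp
  have h3 := abs_le_maxNorm hc hu.u_xx.2 hp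
  have h4 := abs_le_maxNorm hc hu.u_t.2 hp
  have h5 := abs_le_maxNorm hc hu.u_tt.2 hp
  have h6 := abs_le_maxNorm hc hu.u_tx.2 hp
  have h7 := abs_le_maxNorm hc hu.u_txx.2 hp
  have g1 := maxNorm_nonneg (cylinder T) u
  have g2 := maxNorm_nonneg (cylinder T) (dx u)
  have g3 := maxNorm_nonneg (cylinder T) (dx (dx u))
  have g4 := maxNorm_nonneg (cylinder T) (dt T u)
  have g5 := maxNorm_nonneg (cylinder T) (dt T (dt T u))
  have g6 := maxNorm_nonneg (cylinder T) (dt T (dx u))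
  have g7 := maxNorm_nonneg (cylinder T) (dt T (dx (dx u)))
  rw [kappa] at hK
  refine ⟨?_, ?_, ?_, ?_, ?_, ?_, ?_⟩ <;> linarith

lemma HasContDx.hasDerivWithinAt (h : HasContDx T v) {t : ℝ} (ht : t ∈ Icc 0 T) {y : ℝ}
    (hy : y ∈ Icc (0 : ℝ) 1) :
    HasDerivWithinAt (fun y => v (y, t)) (dx v (y, t)) (Icc 0 1) y :=
  (h.1 t ht y hy).hasDerivWithinAt

lemma HasContDt.hasDerivWithinAt (h : HasContDt T v) {t : ℝ} (ht : t ∈ Icc 0 T) {y : ℝ}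
    (hy : y ∈ Icc (0 : ℝ) 1) :
    HasDerivWithinAt (fun s => v (y, s)) (dt T v (y, t)) (Icc 0 T) t :=
  (h.1 y hy t ht).hasDerivWithinAt

lemma continuousOn_slice (h : ContinuousOn v (cylinder T)) {t : ℝ} (ht : t ∈ Icc 0 T) :
    ContinuousOn (fun y => v (y, t)) (Icc 0 1) :=
  h.comp (by fun_prop) fun _ hy => ⟨hy, ht⟩

lemma HasContDt.abs_sub_le (h : HasContDt T v) {B : ℝ} (hB : ∀ p ∈ cylinder T, |dt T v p| ≤ B)
    {y s t : ℝ} (hy : y ∈ Icc (0 : ℝ) 1) (hs : s ∈ Icc 0 T) (ht : t ∈ Icc 0 T) :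
    |v (y, t) - v (y, s)| ≤ B * |t - s| :=
  (convex_Icc 0 T).norm_image_sub_le_of_norm_hasDerivWithin_le
    (fun _ hr => h.hasDerivWithinAt hr hy) (fun _ hr => hB _ ⟨hy, hr⟩) hs ht

lemma abs_sub_le_of_hasDerivWithinAt {g g' : ℝ → ℝ} {B : ℝ}
    (h : ∀ y ∈ Icc (0 : ℝ) 1, HasDerivWithinAt g (g' y) (Icc 0 1) y)
    (hB : ∀ y ∈ Icc (0 : ℝ) 1, |g' y| ≤ B) :
    ∀ a ∈ Icc (0 : ℝ) 1, ∀ b ∈ Icc (0 : ℝ) 1, |g a - g b| ≤ B * |a - b| := fun _ ha _ hb =>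
  (convex_Icc 0 1).norm_image_sub_le_of_norm_hasDerivWithin_le h hB hb ha

/-- The implicit difference quotient in time is first order accurate. -/
lemma IsSmooth.abs_dt_sub_div_le (hu : IsSmooth T u) (hK : kappa T u ≤ K) {y t τ : ℝ}
    (hy : y ∈ Icc (0 : ℝ) 1) (ht : 0 ≤ t) (hτ : 0 < τ) (htT : t + τ ≤ T) :
    |dt T u (y, t + τ) - (u (y, t + τ) - u (y, t)) / τ| ≤ K * τ := by
  have ht' : t + τ ∈ Icc 0 T := ⟨by linarith, htT⟩
  have hsub : Icc t (t + τ) ⊆ Icc 0 T := Icc_subset_Icc ht htT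
  -- Mean value inequality for u minus its linear part at the new time; the bound on u_tt makes the
  -- derivative at most Kτ.
  have hb := (convex_Icc t (t + τ)).norm_image_sub_le_of_norm_hasDerivWithin_le
    (f := fun s => u (y, s) - s * dt T u (y, t + τ))
    (f' := fun s => dt T u (y, s) - 1 * dt T u (y, t + τ)) (C := K * τ)
    (fun s hs => ((hu.u_t.hasDerivWithinAt (hsub hs) hy).mono hsub).sub
      ((hasDerivWithinAt_id s _).mul_const _))
    (fun s hs => by
      rw [Real.norm_eq_abs, one_mul]
      refine (hu.u_tt.abs_sub_le (fun p hp => (hu.abs_le hK hp).2.2.2.2.1) hy ht' (hsub hs)).trans ?_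
      have hK0 : 0 ≤ K := (abs_nonneg _).trans (hu.abs_le hK (p := (y, t + τ)) ⟨hy, ht'⟩).1
      refine mul_le_mul_of_nonneg_left ?_ hK0
      rw [_root_.abs_le]
      constructor <;> linarith [hs.1, hs.2])
    (left_mem_Icc.2 (by linarith)) (right_mem_Icc.2 (by linarith))
  rw [Real.norm_eq_abs, Real.norm_eq_abs, add_sub_cancel_left, abs_of_pos hτ] at hb
  have e : dt T u (y, t + τ) - (u (y, t + τ) - u (y, t)) / τ
      = -(u (y, t + τ) - (t + τ) * dt T u (y, t + τ) - (u (y, t) - t * dt T u (y, t + τ))) / τ := by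
    field_simp
    ring
  rw [e, abs_div, abs_neg, abs_of_pos hτ, div_le_iff₀ hτ]
  exact hb

variable {N : ℕ} {f u0 : ℝ → ℝ}

lemma IsSolution.dirichlet' (hs : IsSolution N f u0 T u) (hu : IsSmooth T u) (hT : 0 < T) {t : ℝ}
    (ht : t ∈ Icc 0 T) : u (1, t) = 0 := by
  have hc : ContinuousOn (fun s => u (1, s)) (Icc 0 T) :=
    hu.cont.comp (by fun_prop) fun s hs => ⟨⟨zero_le_one, le_rfl⟩, hs⟩
  exact Set.EqOn.of_subset_closure (s := Ioc 0 T) (t := Icc 0 T) (f := fun s => u (1, s))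
    (g := fun _ => (0 : ℝ)) (fun s h => hs.dirichlet s h) hc continuousOn_const
    Ioc_subset_Icc_self (closure_Ioc hT.ne).ge ht

lemma IsSolution.initial' (hs : IsSolution N f u0 T u) (hu : IsSmooth T u) (hT : 0 < T)
    (hu0 : ContinuousOn u0 (Icc 0 1)) {y : ℝ} (hy : y ∈ Icc (0 : ℝ) 1) : u (y, 0) = u0 y :=
  Set.EqOn.of_subset_closure (s := Ioo (0 : ℝ) 1) (t := Icc 0 1) (f := fun y => u (y, 0))
    (g := u0) (fun s h => hs.initial s h) (continuousOn_slice hu.cont ⟨le_rfl, hT.le⟩) hu0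
    Ioo_subset_Icc_self (closure_Ioo zero_ne_one).ge hy

/-- Divergence form of the radial equation: x^{N-1}(u_xx + (N-1)u_x/x) = (x^{N-1}u_x)_x. -/
lemma IsSolution.hasDerivAt_flux (hN : 2 ≤ N) (hs : IsSolution N f u0 T u) (hu : IsSmooth T u)
    {t : ℝ} (ht : t ∈ Ioc 0 T) {z : ℝ} (hz : z ∈ Ioo (0 : ℝ) 1) :
    HasDerivAt (fun z => z ^ (N - 1) * dx u (z, t))
      (z ^ (N - 1) * (dt T u (z, t) - f (u (z, t)))) z := by
  have h1 := (hu.u_xx.hasDerivWithinAt (Ioc_subset_Icc_self ht)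
    (Ioo_subset_Icc_self hz)).hasDerivAt (Icc_mem_nhds hz.1 hz.2)
  convert! (hasDerivAt_pow (N - 1) z).mul h1 using 1
  rw [hs.pde z hz t ht]
  obtain ⟨k, rfl⟩ := Nat.exists_eq_add_of_le hN
  have hz0 := hz.1.ne'
  simp only [show 2 + k - 1 = k + 1 by omega, Nat.add_sub_cancel]
  push_cast
  field_simp
  ring

/-- Shows that e^{ct}(a + tb) is a majorant for y' ≤ (1 + cτ)y + τb; it serves both inductions of
the theorem. -/
lemma gronwall_step {c τ t a b : ℝ} (hc : 0 ≤ c) (hτ : 0 ≤ τ) (ht : 0 ≤ t) (ha : 0 ≤ a)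
    (hb : 0 ≤ b) :
    (1 + c * τ) * (Real.exp (c * t) * (a + t * b)) + τ * b
      ≤ Real.exp (c * (t + τ)) * (a + (t + τ) * b) := by
  have h1 := Real.add_one_le_exp (c * τ)
  have h2 : 1 ≤ Real.exp (c * (t + τ)) := Real.one_le_exp (by positivity)
  have h3 : (1 + c * τ) * (Real.exp (c * t) * (a + t * b))
      ≤ Real.exp (c * τ) * (Real.exp (c * t) * (a + t * b)) :=
    mul_le_mul_of_nonneg_right (by linarith) (by positivity)
  have h4 : Real.exp (c * τ) * (Real.exp (c * t) * (a + t * b))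
      = Real.exp (c * (t + τ)) * (a + t * b) := by
    rw [← mul_assoc, ← Real.exp_add]; congr 2; ring
  nlinarith [mul_le_mul_of_nonneg_right h2 (mul_nonneg hτ hb)]

variable {M : Mesh} {τ : ℕ → ℝ} {U : ℕ → ℝ → ℝ}

lemma time_succ (τ : ℕ → ℝ) (n : ℕ) : time τ (n + 1) = time τ n + τ n :=
  Finset.sum_range_succ _ _

lemma time_nonneg (hτ : ∀ j, 0 < τ j) (n : ℕ) : 0 ≤ time τ n :=
  Finset.sum_nonneg fun j _ => (hτ j).le

/-! ### Difference quotients in time. -/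

section quotient

variable (u) in
/-- The difference quotient in time of `u`. -/
noncomputable def quot (t τ y : ℝ) : ℝ := (u (y, t + τ) - u (y, t)) / τ

lemma IsSmooth.hasDerivWithinAt_quot (hu : IsSmooth T u) {t τ : ℝ} (ht : t ∈ Icc 0 T)
    (ht' : t + τ ∈ Icc 0 T) {y : ℝ} (hy : y ∈ Icc (0 : ℝ) 1) :
    HasDerivWithinAt (quot u t τ) (quot (dx u) t τ y) (Icc 0 1) y :=
  ((hu.u_x.hasDerivWithinAt ht' hy).sub (hu.u_x.hasDerivWithinAt ht hy)).div_const τ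

lemma continuousOn_quot (hu : ContinuousOn u (cylinder T)) {t τ : ℝ} (ht : t ∈ Icc 0 T)
    (ht' : t + τ ∈ Icc 0 T) : ContinuousOn (quot u t τ) (Icc 0 1) :=
  ((continuousOn_slice hu ht').sub (continuousOn_slice hu ht)).div_const τ

lemma HasContDt.abs_quot_le (hu : HasContDt T u) (hB : ∀ p ∈ cylinder T, |dt T u p| ≤ K) {t τ : ℝ}
    (hτ : 0 < τ) (ht : t ∈ Icc 0 T) (ht' : t + τ ∈ Icc 0 T) {y : ℝ} (hy : y ∈ Icc (0 : ℝ) 1) :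
    |quot u t τ y| ≤ K := by
  have := hu.abs_sub_le hB hy ht ht'
  rw [add_sub_cancel_left, abs_of_pos hτ] at this
  rwa [quot, abs_div, abs_of_pos hτ, div_le_iff₀ hτ]

/-- The bound on u_txx controls the quotients of u_xx uniformly in τ, so the quotient of u projects
as accurately as u itself. -/
lemma IsSmooth.quot_dx_lipschitz (hu : IsSmooth T u) (hK : kappa T u ≤ K) {t τ : ℝ}
    (hτ : 0 < τ) (ht : t ∈ Icc 0 T) (ht' : t + τ ∈ Icc 0 T) :
    ∀ a ∈ Icc (0 : ℝ) 1, ∀ b ∈ Icc (0 : ℝ) 1,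
      |quot (dx u) t τ a - quot (dx u) t τ b| ≤ K * |a - b| :=
  abs_sub_le_of_hasDerivWithinAt (g' := quot (dx (dx u)) t τ)
    (fun _ hy => ((hu.u_xx.hasDerivWithinAt ht' hy).sub
      (hu.u_xx.hasDerivWithinAt ht hy)).div_const τ)
    (fun _ hy => hu.u_txx.abs_quot_le (fun _ hp => (hu.abs_le hK hp).2.2.2.2.2.2) hτ ht ht' hy)

lemma IsSmooth.dx_lipschitz (hu : IsSmooth T u) (hK : kappa T u ≤ K) {t : ℝ} (ht : t ∈ Icc 0 T) :
    ∀ a ∈ Icc (0 : ℝ) 1, ∀ b ∈ Icc (0 : ℝ) 1, |dx u (a, t) - dx u (b, t)| ≤ K * |a - b| :=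
  abs_sub_le_of_hasDerivWithinAt (g := fun y => dx u (y, t)) (g' := fun y => dx (dx u) (y, t))
    (fun _ hy => hu.u_xx.hasDerivWithinAt ht hy) (fun _ hy => (hu.abs_le hK ⟨hy, ht⟩).2.2.1)

end quotient

/-! ### Error equation and one-step error bounds. -/

/-- The difference of the discrete solution and the elliptic projection of `u` at time `t_n`. -/
noncomputable def err (N : ℕ) (M : Mesh) (u : ℝ × ℝ → ℝ) (τ : ℕ → ℝ) (U : ℕ → ℝ → ℝ) (n : ℕ)
    (y : ℝ) : ℝ :=
  U n y - M.proj N (fun z => dx u (z, time τ n)) y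

lemma IsML1.err_memS (hU : IsML1 N f M τ U) (u : ℝ × ℝ → ℝ) (n : ℕ) :
    M.MemS (err N M u τ U n) := (hU.mem n).sub (M.proj_memS N _)

/-- Subtracting the weak equation of Pu at the new time from the scheme leaves no elliptic residual;
only the reaction and the time derivative contribute to the source. -/
lemma IsML1.err_equation (hN : 2 ≤ N) (hf : Continuous f) (hs : IsSolution N f u0 T u)
    (hu : IsSmooth T u) (hU : IsML1 N f M τ U) (hτ : ∀ j, 0 < τ j) {n : ℕ}
    (hn : time τ (n + 1) ≤ T) {χ : ℝ → ℝ} (hχ : M.MemS χ) :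
    M.lump N (fun y => (err N M u τ U (n + 1) y - err N M u τ U n y) / τ n) χ
        + formA N (err N M u τ U (n + 1)) χ
      = ip N (fun y => f (U n y) - f (u (y, time τ (n + 1))) + dt T u (y, time τ (n + 1))) χ
        - M.lump N (M.proj N (quot (dx u) (time τ n) (τ n))) χ := by
  have ht0 := time_nonneg hτ n
  have hτn := hτ n
  have hts := time_succ τ n
  have ht : time τ n ∈ Icc 0 T := ⟨ht0, by linarith⟩
  have ht' : time τ (n + 1) ∈ Ioc 0 T := ⟨by linarith, hn⟩
  have hc := hχ.cont
  have hcu := continuousOn_slice hu.cont (Ioc_subset_Icc_self ht')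
  have hct := continuousOn_slice hu.u_t.2 (Ioc_subset_Icc_self ht')
  have hcx := continuousOn_slice hu.u_x.2 ht
  have hcx' := continuousOn_slice hu.u_x.2 (Ioc_subset_Icc_self ht')
  have hcU := (hU.mem n).cont
  have hfu : ContinuousOn (fun y => f (u (y, time τ (n + 1)))) (Icc 0 1) := hf.comp_continuousOn hcu
  have hfU : ContinuousOn (fun y => f (U n y)) (Icc 0 1) := hf.comp_continuousOn hcU
  have hA := hχ.formA_proj_eq (N := N) (g := fun y => dx u (y, time τ (n + 1)))
    (F := fun y => dt T u (y, time τ (n + 1)) - f (u (y, time τ (n + 1)))) hN hcx'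
    (hct.sub hfu) (fun z hz => hs.hasDerivAt_flux hN hu ht' hz)
  have hsch := hU.scheme n χ hχ
  have hB : formA N (err N M u τ U (n + 1)) χ = formA N (U (n + 1)) χ
      - formA N (M.proj N fun y => dx u (y, time τ (n + 1))) χ :=
    (hU.mem (n + 1)).formA_sub (M.proj_memS N _) hχ
  have hl : M.lump N (fun y => (err N M u τ U (n + 1) y - err N M u τ U n y) / τ n) χ
      = M.lump N (fun y => (U (n + 1) y - U n y) / τ n) χ
        - M.lump N (M.proj N (quot (dx u) (time τ n) (τ n))) χ := by
    simp only [Mesh.lump]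
    rw [← Finset.sum_sub_distrib]
    refine Finset.sum_congr rfl fun i _ => ?_
    have : M.proj N (quot (dx u) (time τ n) (τ n)) (M.x i)
        = (M.proj N (fun z => dx u (z, time τ (n + 1))) (M.x i)
          - M.proj N (fun z => dx u (z, time τ n)) (M.x i)) / τ n := by
      rw [← Mesh.proj_sub_div hcx' hcx, hts]
      rfl
    rw [this, err, err]
    ring
  have hI : ip N (fun y => f (U n y) - f (u (y, time τ (n + 1))) + dt T u (y, time τ (n + 1))) χ
      = ip N (fun y => f (U n y)) χ
        + ip N (fun y => dt T u (y, time τ (n + 1)) - f (u (y, time τ (n + 1)))) χ := by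
    rw [← ip_add (w := fun y => dt T u (y, time τ (n + 1)) - f (u (y, time τ (n + 1)))) hfU
      (hct.sub hfu) hc]
    exact ip_congr fun y _ => by ring
  rw [hl, hB, hI]
  linarith

lemma add_four_sq_le (a b c d : ℝ) :
    (a + b + c + d) ^ 2 ≤ 4 * (a ^ 2 + b ^ 2 + c ^ 2 + d ^ 2) := by
  linarith [sq_nonneg (a - b), sq_nonneg (a - c), sq_nonneg (a - d), sq_nonneg (b - c),
    sq_nonneg (b - d), sq_nonneg (c - d)]

/-- One time step preserves smallness of the error in the maximum norm and satisfies an energy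
estimate of optimal order. -/
lemma IsML1.err_step (hN : 2 ≤ N) (hf : Continuous f) (hT : 0 < T) {L τm Θ : ℝ} (hL0 : 0 ≤ L)
    (hL : ∀ a ∈ Icc (-(2 * K + 1)) (2 * K + 1), ∀ b ∈ Icc (-(2 * K + 1)) (2 * K + 1),
      |f a - f b| ≤ L * |a - b|)
    (hs : IsSolution N f u0 T u) (hu : IsSmooth T u) (hK : kappa T u ≤ K)
    (hU : IsML1 N f M τ U) (hτ : ∀ j, 0 < τ j) (hτm : ∀ j, τ j ≤ τm) (hh : M.h ≤ 1) {n : ℕ}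
    (hn : time τ (n + 1) ≤ T) (hΘ1 : Θ ≤ 1)
    (hΘ : ∀ i ≤ M.m, |err N M u τ U n (M.x i)| ≤ Θ) :
    (∀ k ≤ M.m, |err N M u τ U (n + 1) (M.x k)|
        ≤ Θ + τ n * (L * Θ + (L + 2) * K * (M.h + τm))) ∧
      (1 - τ n) * M.lump N (err N M u τ U (n + 1)) (err N M u τ U (n + 1))
        ≤ M.lump N (err N M u τ U n) (err N M u τ U n)
          + τ n * (4 * L ^ 2 * M.lump N (err N M u τ U n) (err N M u τ U n)
            + (4 * (L ^ 2 * (2 * N * K) ^ 2 + ((L + 1) * K) ^ 2 + (2 * N * K) ^ 2) + 2 * K ^ 2)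
              * (M.h ^ 2 + τm) ^ 2) := by
  have ht0 := time_nonneg hτ n
  have hτn := hτ n
  have hts := time_succ τ n
  have ht : time τ n ∈ Icc 0 T := ⟨ht0, by linarith⟩
  have ht' : time τ (n + 1) ∈ Icc 0 T := ⟨by linarith, hn⟩
  have htq : time τ n + τ n ∈ Icc 0 T := hts ▸ ht'
  have hK0 : 0 ≤ K := (abs_nonneg _).trans
    (hu.abs_le hK (p := (0, 0)) ⟨⟨le_rfl, zero_le_one⟩, ⟨le_rfl, hT.le⟩⟩).1
  have hh0 := M.h_pos
  have hΘ0 : 0 ≤ Θ := (abs_nonneg _).trans (hΘ 0 (Nat.zero_le _))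
  have hτm0 : 0 ≤ τm := hτn.le.trans (hτm n)
  have hθ := hU.err_memS (N := N) u n
  have hθ' := hU.err_memS (N := N) u (n + 1)
  set W := M.proj N (quot (dx u) (time τ n) (τ n)) with hWdef
  have hW : M.MemS W := M.proj_memS N _
  set E : ℝ → ℝ := fun y =>
    f (U n y) - f (u (y, time τ (n + 1))) + dt T u (y, time τ (n + 1)) with hEdef
  have hcU := (hU.mem n).cont
  have hcu := continuousOn_slice hu.cont ht
  have hcu' := continuousOn_slice hu.cont ht'
  have hE : ContinuousOn E (Icc 0 1) := ((hf.comp_continuousOn hcU).sub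
    (hf.comp_continuousOn hcu')).add (continuousOn_slice hu.u_t.2 ht')
  have H : ∀ χ, M.MemS χ → M.lump N
      (fun y => (err N M u τ U (n + 1) y - err N M u τ U n y) / τ n) χ
      + formA N (err N M u τ U (n + 1)) χ = ip N E χ - M.lump N W χ :=
    fun χ hχ => hU.err_equation hN hf hs hu hτ hn hχ
  -- the projections of `u` and of its difference quotient
  set r : ℝ → ℝ := fun y => M.proj N (fun z => dx u (z, time τ n)) y - u (y, time τ n) with hr
  set q : ℝ → ℝ := quot u (time τ n) (τ n) with hq
  have hgx := continuousOn_slice hu.u_x.2 ht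
  have hgq := continuousOn_quot hu.u_x.2 ht htq
  have hLx := hu.dx_lipschitz hK ht
  have hLq := hu.quot_dx_lipschitz hK hτn ht htq
  have hwx := fun y hy => hu.u_x.hasDerivWithinAt ht (y := y) hy
  have hwq := fun y hy => hu.hasDerivWithinAt_quot ht htq (y := y) hy
  have hx1 : u (1, time τ n) = 0 := hs.dirichlet' hu hT ht
  have hq1 : q 1 = 0 := by
    rw [hq, quot, hx1, hs.dirichlet' hu hT htq, sub_zero, zero_div]
  have hr_sup : ∀ y ∈ Icc (0 : ℝ) 1, |r y| ≤ K * M.h := fun y hy =>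
    Mesh.abs_proj_sub_le (w := fun y => u (y, time τ n)) hgx hK0 hLx hwx hx1 hy
  have hq_sup : ∀ y ∈ Icc (0 : ℝ) 1, |W y - q y| ≤ K * M.h := fun y hy =>
    Mesh.abs_proj_sub_le hgq hK0 hLq hwq hq1 hy
  have hr_w : ∀ y ∈ Icc (0 : ℝ) 1, y * r y ^ 2 ≤ (2 * N * K * M.h ^ 2) ^ 2 := fun y hy =>
    Mesh.weighted_proj_sub_sq_le (w := fun y => u (y, time τ n)) hN hgx hK0 hLx hwx hx1 hy
  have hq_w : ∀ y ∈ Icc (0 : ℝ) 1, y * (W y - q y) ^ 2 ≤ (2 * N * K * M.h ^ 2) ^ 2 := fun y hy =>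
    Mesh.weighted_proj_sub_sq_le hN hgq hK0 hLq hwq hq1 hy
  have hθ_sup : ∀ y ∈ Icc (0 : ℝ) 1, |err N M u τ U n y| ≤ Θ := fun y hy => hθ.abs_le hΘ hy
  have hUeq : ∀ y, U n y = err N M u τ U n y + r y + u (y, time τ n) := fun y => by
    simp only [err, hr]; ring
  -- local consistency
  have hloc : ∀ y ∈ Icc (0 : ℝ) 1,
      |E y - q y| ≤ L * |err N M u τ U n y| + L * |r y| + (L + 1) * K * τ n := by
    intro y hy
    have hu1 := abs_le.1 (hu.abs_le hK (p := (y, time τ n)) ⟨hy, ht⟩).1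
    have hu2 := abs_le.1 (hu.abs_le hK (p := (y, time τ (n + 1))) ⟨hy, ht'⟩).1
    have h1 := abs_le.1 (hr_sup y hy)
    have h2 := abs_le.1 (hθ_sup y hy)
    have h3 : K * M.h ≤ K := mul_le_of_le_one_right hK0 hh
    -- U is a sum of parts bounded by Θ ≤ 1, K h ≤ K and K, hence lies in the interval where f has
    -- Lipschitz constant L.
    have h4 := hL (U n y) ⟨by rw [hUeq]; linarith, by rw [hUeq]; linarith⟩
      (u (y, time τ (n + 1))) ⟨by linarith, by linarith⟩
    have h5 : |u (y, time τ n) - u (y, time τ (n + 1))| ≤ K * τ n := by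
      have := hu.u_t.abs_sub_le (fun p hp => (hu.abs_le hK hp).2.2.2.1) hy ht' ht
      rwa [hts, abs_sub_comm (time τ n), add_sub_cancel_left, abs_of_pos hτn, ← hts] at this
    have h6 : |dt T u (y, time τ (n + 1)) - q y| ≤ K * τ n := by
      rw [hts]; exact hu.abs_dt_sub_div_le hK hy ht0 hτn htq.2
    have h7 : |U n y - u (y, time τ (n + 1))| ≤ |err N M u τ U n y| + |r y| + K * τ n := by
      have e : U n y - u (y, time τ (n + 1))
          = err N M u τ U n y + r y + (u (y, time τ n) - u (y, time τ (n + 1))) := by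
        rw [hUeq]; ring
      rw [e]
      exact (abs_add_three _ _ _).trans (by linarith)
    have h8 : E y - q y = (f (U n y) - f (u (y, time τ (n + 1))))
        + (dt T u (y, time τ (n + 1)) - q y) := by
      simp only [hEdef]; ring
    have h9 := mul_le_mul_of_nonneg_left h7 hL0
    rw [h8]
    exact (abs_add_le _ _).trans (by linarith)
  constructor
  -- E(y) is compared with W at the node through q: the shift y to x_i and the projection error of q
  -- each cost K h, beside L K h from r.
  · refine hθ'.abs_step_le hE hτn H (by positivity) hΘ fun i hi y hy hne => ?_
    have hxi := M.x_mem hi.le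
    have h1 := hloc y hy
    have h2 : |q y - q (M.x i)| ≤ K * M.h := by
      refine (abs_sub_le_of_hasDerivWithinAt hwq (fun y hy => hu.u_tx.abs_quot_le
        (fun _ hp => (hu.abs_le hK hp).2.2.2.2.2.1) hτn ht htq hy) y hy _ hxi).trans ?_
      exact mul_le_mul_of_nonneg_left (M.abs_sub_node_le_h hi hy hne) hK0
    have h3 := hq_sup _ hxi
    rw [abs_sub_comm] at h3
    have e : E y - W (M.x i) = (E y - q y) + (q y - q (M.x i)) + (q (M.x i) - W (M.x i)) := by ring
    rw [e]
    refine (abs_add_three _ _ _).trans ?_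
    have h4 := mul_le_mul_of_nonneg_left (hθ_sup y hy) hL0
    have h5 := mul_le_mul_of_nonneg_left (hr_sup y hy) hL0
    have h6 : (L + 1) * K * τ n ≤ (L + 2) * K * τm := by
      have := hτm n
      gcongr
      linarith
    linarith
  · have hWs : ∀ j < M.m, |M.slope W j| ≤ K := by
      intro j hj
      rw [hWdef, M.slope_proj N _ hj]
      have := Mesh.abs_avg_sub_le (N := N) (c := 0) (B := K) hgq hj fun z hz => by
        rw [sub_zero]
        exact hu.u_tx.abs_quot_le (fun _ hp => (hu.abs_le hK hp).2.2.2.2.2.1) hτn ht htq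
          (M.elem_subset hj hz)
      rwa [sub_zero] at this
    refine (hθ'.lump_step_le hE hW hτn H hWs).trans ?_
    have hcW := hW.cont
    have hcθ := hθ.cont
    have hcq : ContinuousOn q (Icc 0 1) := continuousOn_quot hu.cont ht htq
    have hcr : ContinuousOn r (Icc 0 1) := (M.proj_memS N _).cont.sub hcu
    set δ := M.h ^ 2 + τm with hδ
    have hδ0 : 0 ≤ δ := by positivity
    have hhδ : M.h ^ 2 ≤ δ := by linarith
    have hτδ : τ n ≤ δ := by linarith [hτm n, sq_nonneg M.h]
    -- The part of (E - W)² independent of θ; the factor 4 comes from squaring a sum of four terms.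
    set G : ℝ → ℝ := fun y =>
      4 * (L ^ 2 * r y ^ 2 + ((L + 1) * K * τ n) ^ 2 + (W y - q y) ^ 2) with hG
    have hcG : ContinuousOn G (Icc 0 1) := by fun_prop
    have hG1 : ip N G (fun _ => 1)
        ≤ 4 * (L ^ 2 * (2 * N * K) ^ 2 + ((L + 1) * K) ^ 2 + (2 * N * K) ^ 2) * δ ^ 2 := by
      refine ip_le_of_weighted_le hN hcG continuousOn_const (fun y _ => by
        simp only [hG]; positivity) fun y hy => ?_
      have h1 := mul_le_mul_of_nonneg_left (hr_w y hy) (sq_nonneg L)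
      have h2 := hq_w y hy
      have h3 : (2 * N * K * M.h ^ 2) ^ 2 ≤ (2 * N * K) ^ 2 * δ ^ 2 := by
        rw [← mul_pow]; gcongr
      have h4 : y * ((L + 1) * K * τ n) ^ 2 ≤ ((L + 1) * K) ^ 2 * δ ^ 2 := by
        rw [← mul_pow]
        refine (mul_le_of_le_one_left (sq_nonneg _) hy.2).trans ?_
        gcongr
      have h5 := mul_le_mul_of_nonneg_left h3 (sq_nonneg L)
      simp only [hG]
      linarith
    have hEW : ip N (fun y => E y - W y) (fun y => E y - W y)
        ≤ 4 * L ^ 2 * ip N (err N M u τ U n) (err N M u τ U n) + ip N G (fun _ => 1) := by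
      have e : 4 * L ^ 2 * ip N (err N M u τ U n) (err N M u τ U n) + ip N G (fun _ => 1)
          = ip N (fun y => 4 * L ^ 2 * (err N M u τ U n y * err N M u τ U n y) + G y)
            (fun _ => 1) := by
        rw [ip_add (by fun_prop) hcG continuousOn_const, ← ip_const_mul]
        congr 1
        exact ip_congr fun y _ => by ring
      rw [e]
      refine ip_mono (by fun_prop) (by fun_prop) (by fun_prop) continuousOn_const fun y hy => ?_
      have h1 := hloc y hy
      have h2 : |E y - W y| ≤ L * |err N M u τ U n y| + L * |r y| + (L + 1) * K * τ n
          + |W y - q y| := by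
        have e : E y - W y = (E y - q y) - (W y - q y) := by ring
        rw [e]
        exact (abs_sub _ _).trans (by linarith)
      have h3 := pow_le_pow_left₀ (abs_nonneg _) h2 2
      rw [sq_abs] at h3
      simp only [hG]
      have e1 := sq_abs (err N M u τ U n y)
      have e2 := sq_abs (r y)
      have e3 := sq_abs (W y - q y)
      rw [← e2, ← e3]
      have e4 : err N M u τ U n y * err N M u τ U n y = |err N M u τ U n y| ^ 2 := by
        rw [e1]; ring
      rw [e4]
      have h4 := add_four_sq_le (L * |err N M u τ U n y|) (L * |r y|) ((L + 1) * K * τ n) |W y - q y|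
      rw [mul_pow L, mul_pow L] at h4
      linarith
    have hlump := mul_le_mul_of_nonneg_left (hθ.ip_self_le_lump N)
      (by positivity : 0 ≤ 4 * L ^ 2)
    have h4 : K ^ 2 * M.h ^ 4 ≤ K ^ 2 * δ ^ 2 := by
      have : M.h ^ 4 = (M.h ^ 2) ^ 2 := by ring
      rw [this]
      gcongr
    have hfin := mul_le_mul_of_nonneg_left (show
      ip N (fun y => E y - W y) (fun y => E y - W y) + 2 * (K ^ 2 * M.h ^ 4)
        ≤ 4 * L ^ 2 * M.lump N (err N M u τ U n) (err N M u τ U n)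
          + (4 * (L ^ 2 * (2 * N * K) ^ 2 + ((L + 1) * K) ^ 2 + (2 * N * K) ^ 2) + 2 * K ^ 2)
              * δ ^ 2 by linarith) hτn.le
    linarith

/-- For τ ≤ 1/2 one has (1 + 2τ)(1 - τ) ≥ 1, so multiplying by 1 + 2τ makes the estimate explicit.
-/
lemma le_of_implicit_step_le {τ a a' e L : ℝ} (hτ : 0 ≤ τ) (hτ2 : τ ≤ 1 / 2) (ha : 0 ≤ a)
    (ha' : 0 ≤ a') (he : 0 ≤ e) (h : (1 - τ) * a' ≤ a + τ * (4 * L ^ 2 * a + e)) :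
    a' ≤ (1 + (2 + 8 * L ^ 2) * τ) * a + τ * (2 * e) := by
  have h0 : 0 ≤ 1 - 2 * τ := by linarith
  have h1 := mul_le_mul_of_nonneg_left h (by linarith : 0 ≤ 1 + 2 * τ)
  have h2 : 0 ≤ τ * a' * (1 - 2 * τ) := by positivity
  have h3 : 0 ≤ L ^ 2 * a * τ * (1 - 2 * τ) := by positivity
  have h4 : 0 ≤ e * τ * (1 - 2 * τ) := by positivity
  linarith

/-- Estimates for the initial error. -/
lemma IsML1.err_zero (hN : 2 ≤ N) (hT : 0 < T) {β C₀ : ℝ} (hβ : 0 < β) (hC₀ : 0 < C₀)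
    (hs : IsSolution N f u0 T u) (hu : IsSmooth T u) (hK : kappa T u ≤ K)
    (hu0 : ContinuousOn u0 (Icc 0 1)) (hM : M.QuasiUniform β) (hU : IsML1 N f M τ U)
    (hh : M.h ≤ 1) (h0 : maxNorm (Icc 0 1) (fun x => U 0 x - u0 x) ≤ C₀ * M.h ^ 2) :
    (∀ i ≤ M.m, |err N M u τ U 0 (M.x i)| ≤ (C₀ + K) * M.h) ∧
      M.lump N (err N M u τ U 0) (err N M u τ U 0)
        ≤ (2 * C₀ ^ 2 + 2 * (2 * N * K) ^ 2 + (2 * C₀ * β + K) ^ 2) * (M.h ^ 2) ^ 2 := by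
  have ht0 : time τ 0 = 0 := Finset.sum_range_zero _
  have ht : time τ 0 ∈ Icc 0 T := ⟨ht0.ge, ht0.trans_le hT.le⟩
  have hK0 : 0 ≤ K := (abs_nonneg _).trans
    (hu.abs_le hK (p := (0, 0)) ⟨⟨le_rfl, zero_le_one⟩, ⟨le_rfl, hT.le⟩⟩).1
  have hh0 := M.h_pos
  have hθ := hU.err_memS (N := N) u 0
  have hcU := (hU.mem 0).cont
  have hgx := continuousOn_slice hu.u_x.2 ht
  have hLx := hu.dx_lipschitz hK ht
  have hwx := fun y hy => hu.u_x.hasDerivWithinAt ht (y := y) hy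
  have hx1 : u (1, time τ 0) = 0 := hs.dirichlet' hu hT ht
  have hd : ∀ y ∈ Icc (0 : ℝ) 1, |U 0 y - u (y, time τ 0)| ≤ C₀ * M.h ^ 2 := by
    intro y hy
    rw [ht0, hs.initial' hu hT hu0 hy]
    exact (abs_le_maxNorm (v := fun x => U 0 x - u0 x) isCompact_Icc (hcU.sub hu0) hy).trans h0
  set r : ℝ → ℝ := fun y => M.proj N (fun z => dx u (z, time τ 0)) y - u (y, time τ 0) with hr
  have hr_sup : ∀ y ∈ Icc (0 : ℝ) 1, |r y| ≤ K * M.h := fun y hy =>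
    Mesh.abs_proj_sub_le (w := fun y => u (y, time τ 0)) hgx hK0 hLx hwx hx1 hy
  have hr_w : ∀ y ∈ Icc (0 : ℝ) 1, y * r y ^ 2 ≤ (2 * N * K * M.h ^ 2) ^ 2 := fun y hy =>
    Mesh.weighted_proj_sub_sq_le (w := fun y => u (y, time τ 0)) hN hgx hK0 hLx hwx hx1 hy
  have he : ∀ y, err N M u τ U 0 y = (U 0 y - u (y, time τ 0)) - r y := fun y => by
    simp only [err, hr]; ring
  constructor
  · intro i hi
    have hxi := M.x_mem hi
    rw [he]
    refine (abs_sub _ _).trans ?_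
    have h1 := hd _ hxi
    have h2 := hr_sup _ hxi
    have h3 : C₀ * M.h ^ 2 ≤ C₀ * M.h := by
      rw [sq]
      exact mul_le_mul_of_nonneg_left (mul_le_of_le_one_left hh0.le hh) hC₀.le
    linarith
  -- Quasi-uniformity enters here: a nodal discrepancy 2C₀h² divided by h_j ≥ h/β is O(h).
  · have hslope : ∀ j < M.m, |M.slope (err N M u τ U 0) j| ≤ (2 * C₀ * β + K) * M.h := by
      intro j hj
      have hsp := M.step_pos hj
      have h1 := abs_le.1 (hd _ (M.x_mem hj.le))
      have h2 := abs_le.1 (hd _ (M.x_mem (show j + 1 ≤ M.m from hj)))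
      have h3 := abs_le.1 (Mesh.abs_proj_sub_sub_le (N := N) (w := fun y => u (y, time τ 0)) hgx hK0
        hLx hwx hj (left_mem_Icc.2 (M.x_lt j hj).le))
      rw [← Mesh.step] at h3
      have h4 : C₀ * M.h ^ 2 ≤ C₀ * β * M.h * M.step j := by
        have := mul_le_mul_of_nonneg_left (hM.h_le hβ hj) (mul_nonneg hC₀.le hh0.le)
        linarith
      rw [Mesh.slope, abs_div, abs_of_pos hsp, div_le_iff₀ hsp, abs_le, he, he]
      simp only [hr]
      constructor <;> linarith
    refine (hθ.lump_self_le N hslope).trans ?_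
    have hcr : ContinuousOn r (Icc 0 1) :=
      (M.proj_memS N _).cont.sub (continuousOn_slice hu.cont ht)
    have hcθ := hθ.cont
    have hip : ip N (err N M u τ U 0) (err N M u τ U 0)
        ≤ 2 * (C₀ * M.h ^ 2) ^ 2 + 2 * (2 * N * K * M.h ^ 2) ^ 2 := by
      refine ip_le_of_weighted_le hN hcθ hcθ (fun y _ => mul_self_nonneg _) fun y hy => ?_
      have h1 := sq_le_sq' (abs_le.1 (hd y hy)).1 (abs_le.1 (hd y hy)).2
      have h2 := hr_w y hy
      have h3 : y * (U 0 y - u (y, time τ 0)) ^ 2 ≤ (C₀ * M.h ^ 2) ^ 2 :=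
        (mul_le_of_le_one_left (sq_nonneg _) hy.2).trans h1
      have h4 : err N M u τ U 0 y * err N M u τ U 0 y
          ≤ 2 * (U 0 y - u (y, time τ 0)) ^ 2 + 2 * r y ^ 2 := by
        rw [he]
        nlinarith [sq_nonneg (U 0 y - u (y, time τ 0) + r y)]
      have h5 := mul_le_mul_of_nonneg_left h4 hy.1
      linarith
    refine (add_le_add_left hip _).trans (le_of_eq ?_)
    ring

/-- The total error is controlled by the lumped norm of `err` and the projection error. -/
lemma IsML1.ip_sub_le (hN : 2 ≤ N) (hT : 0 < T) (hs : IsSolution N f u0 T u) (hu : IsSmooth T u)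
    (hK : kappa T u ≤ K) (hU : IsML1 N f M τ U) (hτ : ∀ j, 0 < τ j) {n : ℕ}
    (hn : time τ n ≤ T) :
    ip N (fun x => U n x - u (x, time τ n)) (fun x => U n x - u (x, time τ n))
      ≤ 2 * M.lump N (err N M u τ U n) (err N M u τ U n) + 2 * (2 * N * K * M.h ^ 2) ^ 2 := by
  have ht : time τ n ∈ Icc 0 T := ⟨time_nonneg hτ n, hn⟩
  have hK0 : 0 ≤ K := (abs_nonneg _).trans
    (hu.abs_le hK (p := (0, 0)) ⟨⟨le_rfl, zero_le_one⟩, ⟨le_rfl, hT.le⟩⟩).1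
  have hθ := hU.err_memS (N := N) u n
  have hcθ := hθ.cont
  have hcU := (hU.mem n).cont
  have hcu := continuousOn_slice hu.cont ht
  have hcd : ContinuousOn (fun x => U n x - u (x, time τ n)) (Icc 0 1) := hcU.sub hcu
  set r : ℝ → ℝ := fun y => M.proj N (fun z => dx u (z, time τ n)) y - u (y, time τ n) with hr
  have hcr : ContinuousOn r (Icc 0 1) := (M.proj_memS N _).cont.sub hcu
  have hrr : ip N r r ≤ (2 * N * K * M.h ^ 2) ^ 2 := by
    refine ip_le_of_weighted_le hN hcr hcr (fun y _ => mul_self_nonneg _) fun y hy => ?_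
    rw [← sq]
    exact Mesh.weighted_proj_sub_sq_le (w := fun y => u (y, time τ n)) hN
      (continuousOn_slice hu.u_x.2 ht) hK0 (hu.dx_lipschitz hK ht)
      (fun y hy => hu.u_x.hasDerivWithinAt ht hy) (hs.dirichlet' hu hT ht) hy
  have hsum : ip N (fun x => U n x - u (x, time τ n)) (fun x => U n x - u (x, time τ n))
      ≤ 2 * ip N (err N M u τ U n) (err N M u τ U n) + 2 * ip N r r := by
    have e : 2 * ip N (err N M u τ U n) (err N M u τ U n) + 2 * ip N r r
        = ip N (fun y => 2 * (err N M u τ U n y * err N M u τ U n y) + 2 * (r y * r y))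
          (fun _ => 1) := by
      rw [ip_add (by fun_prop) (by fun_prop) continuousOn_const, ← ip_const_mul, ← ip_const_mul]
      congr 1 <;> exact ip_congr fun y _ => by ring
    rw [e]
    refine ip_mono hcd hcd (by fun_prop) continuousOn_const fun y _ => ?_
    have : U n y - u (y, time τ n) = err N M u τ U n y + r y := by simp only [err, hr]; ring
    rw [this]
    nlinarith [sq_nonneg (err N M u τ U n y - r y)]
  have := hθ.ip_self_le_lump N
  linarith

end RadialHeat

/-! ### The error estimate. -/

open RadialHeat

theorem theorem2p4 (N : ℕ) (hN : 2 ≤ N) (f : ℝ → ℝ) (hf : LocallyLipschitz f)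
    (T : ℝ) (hT : 0 < T) (K : ℝ) (C₀ : ℝ) (hC₀ : 0 < C₀) (β : ℝ) (hβ : 0 < β) :
    ∃ C > 0, ∃ h₀ > 0, ∃ τ₀ > 0,
      ∀ (u0 : ℝ → ℝ) (u : ℝ × ℝ → ℝ),
        ContinuousOn u0 (Set.Icc 0 1) →
        RadialHeat.IsSolution N f u0 T u →
        RadialHeat.IsSmooth T u →
        RadialHeat.kappa T u ≤ K →
      ∀ (M : RadialHeat.Mesh) (τ : ℕ → ℝ) (τmax : ℝ) (U : ℕ → ℝ → ℝ),
        M.QuasiUniform β →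
        (∀ j, 0 < τ j) →
        IsLUB (Set.range τ) τmax →
        M.h ≤ h₀ →
        τmax ≤ τ₀ →
        RadialHeat.IsML1 N f M τ U →
        RadialHeat.maxNorm (Set.Icc 0 1) (fun x => U 0 x - u0 x) ≤ C₀ * M.h ^ 2 →
        ∀ n, RadialHeat.time τ n ≤ T →
          RadialHeat.wnorm N (fun x => U n x - u (x, RadialHeat.time τ n))
            ≤ C * (M.h ^ 2 + τmax) := by
  obtain ⟨L, hL⟩ := (hf.locallyLipschitzOn (s := Icc (-(2 * K + 1)) (2 * K + 1))
    ).exists_lipschitzOnWith_of_compact isCompact_Icc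
  have hL0 : 0 ≤ (L : ℝ) := L.2
  have hL' : ∀ a ∈ Icc (-(2 * K + 1)) (2 * K + 1), ∀ b ∈ Icc (-(2 * K + 1)) (2 * K + 1),
      |f a - f b| ≤ L * |a - b| := fun a ha b hb => hL.dist_le_mul a ha b hb
  generalize (L : ℝ) = L at hL0 hL'
  clear hL
  -- Q(h + τ) dominates the maximum-norm Gronwall majorant up to time T. The absolute value keeps Q
  -- positive before a solution, which forces K ≥ 0, is given.
  set Q : ℝ := Real.exp (L * T) * ((C₀ + |K|) + T * ((L + 2) * |K|)) with hQ
  have hQ0 : 0 < Q := by positivity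
  set C₁ : ℝ := 4 * (L ^ 2 * (2 * N * K) ^ 2 + ((L + 1) * K) ^ 2 + (2 * N * K) ^ 2) + 2 * K ^ 2
    with hC₁
  have hC₁0 : 0 ≤ C₁ := by positivity
  set C₂ : ℝ := 2 * C₀ ^ 2 + 2 * (2 * N * K) ^ 2 + (2 * C₀ * β + K) ^ 2 with hC₂
  have hC₂0 : 0 ≤ C₂ := by positivity
  set c : ℝ := 2 + 8 * L ^ 2 with hc
  have hc0 : 0 ≤ c := by positivity
  set D : ℝ := 2 * (Real.exp (c * T) * (C₂ + T * (2 * C₁))) + 2 * (2 * N * K) ^ 2 with hD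
  have hD0 : 0 ≤ D := by positivity
  -- The thresholds 1/(2Q) make Q(h + τ) ≤ 1, and τ ≤ 1/2 allows the implicit step to be solved;
  -- adding 1 to √D makes C positive.
  refine ⟨√D + 1, by positivity, min 1 (1 / (2 * Q)), by positivity,
    min (1 / 2) (1 / (2 * Q)), by positivity, ?_⟩
  intro u0 u hu0 hs hu hK M τ τmax U hM hτ hlub hh hτ₀ hU h0 n hn
  have hK0 : 0 ≤ K := (abs_nonneg _).trans
    (hu.abs_le hK (p := (0, 0)) ⟨⟨le_rfl, zero_le_one⟩, ⟨le_rfl, hT.le⟩⟩).1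
  have hτm : ∀ j, τ j ≤ τmax := fun j => hlub.1 ⟨j, rfl⟩
  have hτm0 : 0 < τmax := (hτ 0).trans_le (hτm 0)
  have hh1 : M.h ≤ 1 := hh.trans (min_le_left _ _)
  have hh0 := M.h_pos
  have hhQ : M.h ≤ 1 / (2 * Q) := hh.trans (min_le_right _ _)
  have hτQ : τmax ≤ 1 / (2 * Q) := hτ₀.trans (min_le_right _ _)
  have hτ2 : τmax ≤ 1 / 2 := hτ₀.trans (min_le_left _ _)
  rw [abs_of_nonneg hK0] at hQ
  obtain ⟨hz1, hz2⟩ := hU.err_zero (N := N) hN hT hβ hC₀ hs hu hK hu0 hM hh1 h0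
  set b : ℝ := (L + 2) * K * (M.h + τmax) with hb
  have hb0 : 0 ≤ b := by positivity
  have hsmall : ∀ k, time τ k ≤ T →
      Real.exp (L * time τ k) * ((C₀ + K) * M.h + time τ k * b) ≤ 1 := by
    intro k hk
    have ht0 := time_nonneg hτ k
    calc Real.exp (L * time τ k) * ((C₀ + K) * M.h + time τ k * b)
        ≤ Real.exp (L * T) * ((C₀ + K) * (M.h + τmax) + T * b) := by
          gcongr
          linarith
      _ = Q * (M.h + τmax) := by rw [hQ, hb]; ring
      _ ≤ Q * (1 / (2 * Q) + 1 / (2 * Q)) := by gcongr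
      _ = 1 := by field_simp; norm_num
  -- The majorant itself serves as Θ in the next step; `hsmall` keeps it at most 1, so the Lipschitz
  -- constant remains valid throughout.
  have hsup : ∀ k, time τ k ≤ T → ∀ i ≤ M.m, |err N M u τ U k (M.x i)|
      ≤ Real.exp (L * time τ k) * ((C₀ + K) * M.h + time τ k * b) := by
    intro k
    induction k with
    | zero =>
      intro _ i hi
      have : time τ 0 = 0 := Finset.sum_range_zero _
      simpa [this] using hz1 i hi
    | succ k ih =>
      intro hk i hi
      have hk' : time τ k ≤ T := by linarith [time_succ τ k, hτ k]
      have h1 := (hU.err_step hN hf.continuous hT hL0 hL' hs hu hK hτ hτm hh1 hk (hsmall k hk')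
        (ih hk')).1 i hi
      have h2 := gronwall_step (c := L) (τ := τ k) (t := time τ k) (a := (C₀ + K) * M.h) (b := b)
        hL0 (hτ k).le (time_nonneg hτ k) (by positivity) hb0
      rw [time_succ]
      linarith
  set δ := M.h ^ 2 + τmax with hδ
  have hδ0 : 0 ≤ δ := by positivity
  have hhδ : M.h ^ 2 ≤ δ := by linarith
  have hen : ∀ k, time τ k ≤ T → M.lump N (err N M u τ U k) (err N M u τ U k)
      ≤ Real.exp (c * time τ k) * (C₂ * δ ^ 2 + time τ k * (2 * C₁ * δ ^ 2)) := by
    intro k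
    induction k with
    | zero =>
      intro _
      have : time τ 0 = 0 := Finset.sum_range_zero _
      rw [this, mul_zero, Real.exp_zero, zero_mul, one_mul, add_zero]
      refine hz2.trans ?_
      gcongr
    | succ k ih =>
      intro hk
      have hk' : time τ k ≤ T := by linarith [time_succ τ k, hτ k]
      have h1 := (hU.err_step hN hf.continuous hT hL0 hL' hs hu hK hτ hτm hh1 hk (hsmall k hk')
        (hsup k hk')).2
      have h2 := gronwall_step (c := c) (τ := τ k) (t := time τ k) (a := C₂ * δ ^ 2)
        (b := 2 * C₁ * δ ^ 2) hc0 (hτ k).le (time_nonneg hτ k) (by positivity) (by positivity)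
      have hτk := hτ k
      have hτk2 : τ k ≤ 1 / 2 := (hτm k).trans hτ2
      rw [← hC₁, ← hδ] at h1
      have hpos : ∀ k, 0 ≤ M.lump N (err N M u τ U k) (err N M u τ U k) := fun k =>
        (ip_nonneg fun y _ => mul_self_nonneg _).trans
          ((hU.err_memS (N := N) u k).ip_self_le_lump N)
      have ha := hpos k
      have ha' := hpos (k + 1)
      have hi := ih hk'
      set a := M.lump N (err N M u τ U k) (err N M u τ U k)
      set a' := M.lump N (err N M u τ U (k + 1)) (err N M u τ U (k + 1))
      have h3 : a' ≤ (1 + c * τ k) * a + τ k * (2 * C₁ * δ ^ 2) := by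
        have := le_of_implicit_step_le hτk.le hτk2 ha ha' (by positivity : 0 ≤ C₁ * δ ^ 2) h1
        rwa [← hc, ← mul_assoc 2] at this
      have h8 := mul_le_mul_of_nonneg_left hi (by positivity : 0 ≤ 1 + c * τ k)
      rw [time_succ]
      linarith
  have hfin := hU.ip_sub_le (N := N) hN hT hs hu hK hτ hn
  have hDn : ip N (fun x => U n x - u (x, time τ n)) (fun x => U n x - u (x, time τ n))
      ≤ D * δ ^ 2 := by
    have h1 := hen n hn
    have ht0 := time_nonneg hτ n
    have h2 : Real.exp (c * time τ n) * (C₂ * δ ^ 2 + time τ n * (2 * C₁ * δ ^ 2))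
        ≤ Real.exp (c * T) * (C₂ * δ ^ 2 + T * (2 * C₁ * δ ^ 2)) := by
      gcongr
    have h3 : (2 * N * K * M.h ^ 2) ^ 2 ≤ (2 * N * K) ^ 2 * δ ^ 2 := by
      rw [← mul_pow]; gcongr
    rw [hD]
    linarith
  rw [wnorm]
  calc √(ip N (fun x => U n x - u (x, time τ n)) (fun x => U n x - u (x, time τ n)))
      ≤ √(D * δ ^ 2) := Real.sqrt_le_sqrt hDn
    _ = √D * δ := by rw [Real.sqrt_mul hD0, Real.sqrt_sq hδ0]
    _ ≤ (√D + 1) * δ := by gcongr; linarith
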